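/- Let $\mathbb{C}_g$ be either the open left half-plane (continuous time) or the open unit disc (discrete time), and call a real square matrix asymptotically stable if all its eigenvalues lie in $\mathbb{C}_g$. $\sigma(\cdot)$ denotes the spectrum as a multiset (complex eigenvalues with algebraic multiplicity) and $\uplus$ the union with multiplicities. $\mathcal{D}$ denotes the time derivative or the unit shift. Consider the real system $$\mathcal{D}x=Ax+Bu+Hw,\qquad y=Cx+D_yu+G_yw,\qquad z=Ex+D_zu+G_zw,$$ with $x\in\mathcal{X}=\mathbb{R}^n$, $u\in\mathbb{R}^m$, $w\in\mathcal{W}=\mathbb{R}^q$, $y\in\mathbb{R}^p$, $z\in\mathcal{Z}=\mathbb{R}^r$. Assume that $(A,B)$ is asymptotically stabilizable ($A+BF$ is asymptotically stable for some $F$) and that $(C,A)$ is asymptotically detectable ($A+GC$ is asymptotically stable for some $G$). **Problem 2.** Find a compensator $\mathcal{D}p=A_cp+B_cy$, $u=C_cp+D_cy$ (of some order $s\ge 0$) such that $I-D_yD_c$ is non-singular and, with $W=(I-D_yD_c)^{-1}$ and $$\widehat A=\begin{bmatrix}A+BD_cWC & BC_c+BD_cWD_yC_c\\ B_cWC & A_c+B_cWD_yC_c\end{bmatrix},\quad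 \widehat H=\begin{bmatrix}H+BD_cWG_y\\ B_cWG_y\end{bmatrix},$$ $$\widehat C=\begin{bmatrix}E+D_zD_cWC & D_zC_c+D_zD_cWD_yC_c\end{bmatrix},\quad \widehat G=G_z+D_zD_cWG_y,$$ the closed-loop transfer function matrix $\widehat C(\lambda I-\widehat A)^{-1}\widehat H+\widehat G$ is zero and $\widehat A$ is asymptotically stable. **Definitions.** A subspace $\mathcal{V}\subseteq\mathcal{X}$ is $(A,B,E,D_z)$-output nulling if $\begin{bmatrix}A\\E\end{bmatrix}\mathcal{V}\subseteq(\mathcal{V}\oplus 0_{\mathcal{Z}})+\operatorname{im}\begin{bmatrix}B\\D_z\end{bmatrix}$; a matrix $F$ is an output nulling friend of $\mathcal{V}$ if $\begin{bmatrix}A+BF\\E+D_zF\end{bmatrix}\mathcal{V}\subseteq\mathcal{V}\oplus 0_{\mathcal{Z}}$; and $\mathcal{V}$ is an $(A,B,E,D_z)$-stabilizability output nulling subspace if it is output nulling and has an output nulling friend $F$ with $\sigma(A+BF\,|\,\mathcal{V})\subset\mathbb{C}_g$. A subspace $\mathcal{S}\subseteq\mathcal{X}$ is $(A,H,C,G_y)$-input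 containing if $[A\;\;H]\big((\mathcal{S}\oplus\mathcal{W})\cap\ker[C\;\;G_y]\big)\subseteq\mathcal{S}$; a matrix $G$ is an input containing friend of $\mathcal{S}$ if $[A+GC\;\;H+GG_y](\mathcal{S}\oplus\mathcal{W})\subseteq\mathcal{S}$; and $\mathcal{S}$ is an $(A,H,C,G_y)$-detectability input containing subspace if it is input containing and has an input containing friend $G$ with $\sigma(A+GC\,|\,\mathcal{X}/\mathcal{S})\subset\mathbb{C}_g$. **Corollary.** Problem 2 is solvable if and only if there exist an $(A,B,E,D_z)$-stabilizability output nulling subspace $\mathcal{V}$, an $(A,H,C,G_y)$-detectability input containing subspace $\mathcal{S}$ and a matrix $K\in\mathbb{R}^{m\times p}$ such that (i) $\operatorname{im}\begin{bmatrix}H\\G_z\end{bmatrix}\subseteq(\mathcal{V}\oplus 0_{\mathcal{Z}})+\operatorname{im}\begin{bmatrix}B\\D_z\end{bmatrix}$; (ii) $[E\;\;G_z]\big((\mathcal{S}\oplus\mathcal{W})\cap\ker[C\;\;G_y]\big)=0_{\mathcal{Z}}$; (iii) $\mathcal{S}\subseteq\mathcal{V}$; (iv) $I+KD_y$ is non-singular,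 and $\begin{bmatrix}A+BKC & H+BKG_y\\ E+D_zKC & G_z+D_zKG_y\end{bmatrix}(\mathcal{S}\oplus\mathcal{W})\subseteq\mathcal{V}\oplus 0_{\mathcal{Z}}$. Moreover, for every such triple $(\mathcal{V},\mathcal{S},K)$ there are an output nulling friend $F$ of $\mathcal{V}$ with $A+BF$ asymptotically stable and an input containing friend $G$ of $\mathcal{S}$ with $A+GC$ asymptotically stable; and for all such $F$ and $G$ the compensator $$A_c=A+GC+(B+GD_y)(I+KD_y)^{-1}(F-KC),\qquad B_c=(B+GD_y)(I+KD_y)^{-1}K-G,$$ $$C_c=(I+KD_y)^{-1}(F-KC),\qquad D_c=(I+KD_y)^{-1}K$$ solves Problem 2, and its closed-loop spectrum is $\sigma(\widehat A)=\sigma(A+BF)\uplus\sigma(A+GC)$. -/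

import Mathlib

open scoped Matrix

/-- The two time axes: `ℝ⁺` (continuous time) and `ℕ` (discrete time). -/
inductive TimeDomain where
  | continuous
  | discrete

/-- The stability region `ℂ_g`: the open left half-plane in continuous time, the open unit disc
in discrete time. -/
def TimeDomain.stabilityRegion : TimeDomain → Set ℂ
  | .continuous => {z : ℂ | z.re < 0}
  | .discrete => {z : ℂ | ‖z‖ < 1}

noncomputable section

/-- The spectrum `σ(f)` of an endomorphism of a finite-dimensional real space: the multiset of its
complex eigenvalues, counted with algebraic multiplicity. -/
def endSpectrum {X : Type*} [AddCommGroup X] [Module ℝ X] [Module.Finite ℝ X]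
    (f : Module.End ℝ X) : Multiset ℂ :=
  (f.charpoly.map (algebraMap ℝ ℂ)).roots

/-- The spectrum `σ(M)` of a real square matrix: the multiset of its complex eigenvalues, counted
with algebraic multiplicity. -/
def matSpectrum {ι : Type*} [Fintype ι] [DecidableEq ι] (M : Matrix ι ι ℝ) : Multiset ℂ :=
  (M.charpoly.map (algebraMap ℝ ℂ)).roots

/-- `M` is asymptotically stable: `σ(M) ⊂ ℂ_g`. -/
def IsAsympStable (T : TimeDomain) {ι : Type*} [Fintype ι] [DecidableEq ι]
    (M : Matrix ι ι ℝ) : Prop :=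
  ∀ z ∈ matSpectrum M, z ∈ T.stabilityRegion

/-- The pair `(A, B)` is asymptotically stabilizable. -/
def IsStabilizablePair (T : TimeDomain) {n m : ℕ} (A : Matrix (Fin n) (Fin n) ℝ)
    (B : Matrix (Fin n) (Fin m) ℝ) : Prop :=
  ∃ F : Matrix (Fin m) (Fin n) ℝ, IsAsympStable T (A + B * F)

/-- The pair `(C, A)` is asymptotically detectable. -/
def IsDetectablePair (T : TimeDomain) {n p : ℕ} (C : Matrix (Fin p) (Fin n) ℝ)
    (A : Matrix (Fin n) (Fin n) ℝ) : Prop :=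
  ∃ G : Matrix (Fin n) (Fin p) ℝ, IsAsympStable T (A + G * C)

section Quadruple

variable {n m p : ℕ} (A : Matrix (Fin n) (Fin n) ℝ) (B : Matrix (Fin n) (Fin m) ℝ)
  (C : Matrix (Fin p) (Fin n) ℝ) (D : Matrix (Fin p) (Fin m) ℝ)

/-- `V` is `(A,B,C,D)`-output nulling: `[A; C] V ⊆ (V ⊕ 0) + im [B; D]`. -/
def IsOutputNulling (V : Submodule ℝ (Fin n → ℝ)) : Prop :=
  V.map (A.mulVecLin.prod C.mulVecLin) ≤
    V.prod ⊥ ⊔ LinearMap.range (B.mulVecLin.prod D.mulVecLin)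

/-- `F` is an `(A,B,C,D)`-output nulling friend of `V`: `[A + B F; C + D F] V ⊆ V ⊕ 0`. -/
def IsOutputNullingFriend (V : Submodule ℝ (Fin n → ℝ)) (F : Matrix (Fin m) (Fin n) ℝ) : Prop :=
  V.map ((A + B * F).mulVecLin.prod (C + D * F).mulVecLin) ≤ V.prod ⊥

/-- `S` is `(A,B,C,D)`-input containing: `[A B] ((S ⊕ U) ∩ ker [C D]) ⊆ S`. -/
def IsInputContaining (S : Submodule ℝ (Fin n → ℝ)) : Prop :=
  (S.prod ⊤ ⊓ LinearMap.ker (C.mulVecLin.coprod D.mulVecLin)).map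
    (A.mulVecLin.coprod B.mulVecLin) ≤ S

/-- `G` is an `(A,B,C,D)`-input containing friend of `S`: `[A + G C, B + G D] (S ⊕ U) ⊆ S`. -/
def IsInputContainingFriend (S : Submodule ℝ (Fin n → ℝ)) (G : Matrix (Fin n) (Fin p) ℝ) : Prop :=
  (S.prod ⊤).map ((A + G * C).mulVecLin.coprod (B + G * D).mulVecLin) ≤ S

variable {A B C D}

theorem IsOutputNullingFriend.mapsTo {V : Submodule ℝ (Fin n → ℝ)} {F : Matrix (Fin m) (Fin n) ℝ}
    (h : IsOutputNullingFriend A B C D V F) : ∀ x ∈ V, (A + B * F).mulVecLin x ∈ V := by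
  intro x hx
  have h2 := h (Submodule.mem_map_of_mem hx)
  exact (Submodule.mem_prod.mp h2).1

theorem IsInputContainingFriend.le_comap {S : Submodule ℝ (Fin n → ℝ)}
    {G : Matrix (Fin n) (Fin p) ℝ} (h : IsInputContainingFriend A B C D S G) :
    S ≤ S.comap (A + G * C).mulVecLin := by
  intro x hx
  have hmem : ((x, 0) : (Fin n → ℝ) × (Fin m → ℝ)) ∈ S.prod ⊤ := ⟨hx, trivial⟩
  have h2 := h (Submodule.mem_map_of_mem hmem)
  simpa using h2

variable (A B C D)

/-- `V` is an `(A,B,C,D)`-stabilizability output nulling subspace: it is output nulling and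
`σ(A + B F | V) ⊂ ℂ_g` for some output nulling friend `F` of `V`. -/
def IsStabilizabilityOutputNulling (T : TimeDomain) (V : Submodule ℝ (Fin n → ℝ)) : Prop :=
  IsOutputNulling A B C D V ∧
    ∃ (F : Matrix (Fin m) (Fin n) ℝ) (hF : IsOutputNullingFriend A B C D V F),
      ∀ z ∈ endSpectrum ((A + B * F).mulVecLin.restrict hF.mapsTo), z ∈ T.stabilityRegion

/-- `S` is an `(A,B,C,D)`-detectability input containing subspace: it is input containing and
`σ(A + G C | X / S) ⊂ ℂ_g` for some input containing friend `G` of `S`. -/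
def IsDetectabilityInputContaining (T : TimeDomain) (S : Submodule ℝ (Fin n → ℝ)) : Prop :=
  IsInputContaining A B C D S ∧
    ∃ (G : Matrix (Fin n) (Fin p) ℝ) (hG : IsInputContainingFriend A B C D S G),
      ∀ z ∈ endSpectrum (S.mapQ S (A + G * C).mulVecLin hG.le_comap), z ∈ T.stabilityRegion

end Quadruple

/-- The plant `Σ`: `𝒟x = A x + B u + H w`, `y = C x + D_y u + G_y w`, `z = E x + D_z u + G_z w`. -/
structure Plant (n m q p r : ℕ) where
  A : Matrix (Fin n) (Fin n) ℝ
  B : Matrix (Fin n) (Fin m) ℝ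
  H : Matrix (Fin n) (Fin q) ℝ
  C : Matrix (Fin p) (Fin n) ℝ
  Dy : Matrix (Fin p) (Fin m) ℝ
  Gy : Matrix (Fin p) (Fin q) ℝ
  E : Matrix (Fin r) (Fin n) ℝ
  Dz : Matrix (Fin r) (Fin m) ℝ
  Gz : Matrix (Fin r) (Fin q) ℝ

/-- A regulator `Σ_C` of order `s`: `𝒟p = A_c p + B_c y`, `u = C_c p + D_c y`. -/
structure Compensator (m p s : ℕ) where
  Ac : Matrix (Fin s) (Fin s) ℝ
  Bc : Matrix (Fin s) (Fin p) ℝ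
  Cc : Matrix (Fin m) (Fin s) ℝ
  Dc : Matrix (Fin m) (Fin p) ℝ

/-- The transfer function matrix `C (λ I - A)⁻¹ B + D`, with entries in the field `ℝ(λ)`. -/
def transferMatrix {ι κ o : Type*} [Fintype ι] [DecidableEq ι]
    (A : Matrix ι ι ℝ) (B : Matrix ι κ ℝ) (C : Matrix o ι ℝ) (D : Matrix o κ ℝ) :
    Matrix o κ (RatFunc ℝ) :=
  C.map RatFunc.C * ((RatFunc.X : RatFunc ℝ) • (1 : Matrix ι ι (RatFunc ℝ)) - A.map RatFunc.C)⁻¹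
    * B.map RatFunc.C + D.map RatFunc.C

namespace Plant

variable {n m q p r s : ℕ} (P : Plant n m q p r) (c : Compensator m p s)

/-- Well-posedness of the feedback interconnection: `I - D_y D_c` is non-singular. -/
def IsWellPosed : Prop := IsUnit (1 - P.Dy * c.Dc)

/-- `W = (I - D_y D_c)⁻¹`. -/
def W : Matrix (Fin p) (Fin p) ℝ := (1 - P.Dy * c.Dc)⁻¹

/-- The closed-loop state matrix `Â`. -/
def clA : Matrix (Fin n ⊕ Fin s) (Fin n ⊕ Fin s) ℝ :=
  Matrix.fromBlocks
    (P.A + P.B * c.Dc * P.W c * P.C) (P.B * c.Cc + P.B * c.Dc * P.W c * P.Dy * c.Cc)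
    (c.Bc * P.W c * P.C) (c.Ac + c.Bc * P.W c * P.Dy * c.Cc)

/-- The closed-loop disturbance input matrix `Ĥ`. -/
def clH : Matrix (Fin n ⊕ Fin s) (Fin q) ℝ :=
  Matrix.fromRows (P.H + P.B * c.Dc * P.W c * P.Gy) (c.Bc * P.W c * P.Gy)

/-- The closed-loop output matrix `Ĉ`. -/
def clC : Matrix (Fin r) (Fin n ⊕ Fin s) ℝ :=
  Matrix.fromCols
    (P.E + P.Dz * c.Dc * P.W c * P.C) (P.Dz * c.Cc + P.Dz * c.Dc * P.W c * P.Dy * c.Cc)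

/-- The closed-loop feedthrough matrix `Ĝ`. -/
def clG : Matrix (Fin r) (Fin q) ℝ := P.Gz + P.Dz * c.Dc * P.W c * P.Gy

/-- The compensator `c` solves the disturbance decoupling problem by dynamic output feedback with
stability for the plant `P`: the interconnection is well posed, the closed-loop transfer function
matrix from `w` to `z` is zero, and the closed-loop eigenvalues are in `ℂ_g`. -/
def SolvesDDPStable (T : TimeDomain) : Prop :=
  P.IsWellPosed c ∧
    transferMatrix (P.clA c) (P.clH c) (P.clC c) (P.clG c) = 0 ∧
    IsAsympStable T (P.clA c)

/-- The disturbance decoupling problem by dynamic output feedback with stability is solvable: some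
compensator, of some order, solves it. -/
def DDPStableSolvable (T : TimeDomain) : Prop :=
  ∃ (s : ℕ) (c : Compensator m p s), P.SolvesDDPStable c T

/-- The solvability conditions (i)-(iv) on `V`, `S` and `K`. -/
structure GeometricConditions (V S : Submodule ℝ (Fin n → ℝ)) (K : Matrix (Fin m) (Fin p) ℝ) :
    Prop where
  /-- `im [H; G_z] ⊆ (V ⊕ 0) + im [B; D_z]` -/
  cond_i : LinearMap.range (P.H.mulVecLin.prod P.Gz.mulVecLin) ≤
    V.prod ⊥ ⊔ LinearMap.range (P.B.mulVecLin.prod P.Dz.mulVecLin)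
  /-- `[E G_z] ((S ⊕ 𝒲) ∩ ker [C G_y]) = 0` -/
  cond_ii : (S.prod ⊤ ⊓ LinearMap.ker (P.C.mulVecLin.coprod P.Gy.mulVecLin)).map
    (P.E.mulVecLin.coprod P.Gz.mulVecLin) = ⊥
  /-- `S ⊆ V` -/
  cond_iii : S ≤ V
  /-- `I + K D_y` is non-singular -/
  cond_iv_wellPosed : IsUnit (1 + K * P.Dy)
  /-- `[A + B K C, H + B K G_y; E + D_z K C, G_z + D_z K G_y] (S ⊕ 𝒲) ⊆ V ⊕ 0` -/
  cond_iv_incl : (S.prod ⊤).map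
    (((P.A + P.B * K * P.C).mulVecLin.coprod (P.H + P.B * K * P.Gy).mulVecLin).prod
      ((P.E + P.Dz * K * P.C).mulVecLin.coprod (P.Gz + P.Dz * K * P.Gy).mulVecLin)) ≤ V.prod ⊥

/-- The compensator of order `n` built from `F`, `G` and `K`. -/
def decouplingCompensator (F : Matrix (Fin m) (Fin n) ℝ) (G : Matrix (Fin n) (Fin p) ℝ)
    (K : Matrix (Fin m) (Fin p) ℝ) : Compensator m p n where
  Ac := P.A + G * P.C + (P.B + G * P.Dy) * (1 + K * P.Dy)⁻¹ * (F - K * P.C)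
  Bc := (P.B + G * P.Dy) * (1 + K * P.Dy)⁻¹ * K - G
  Cc := (1 + K * P.Dy)⁻¹ * (F - K * P.C)
  Dc := (1 + K * P.Dy)⁻¹ * K

end Plant

end

/-!
Stability is handled through annihilating polynomials: an endomorphism is stable iff some real
polynomial with all its roots in the stability region annihilates it (`endSpectrum_stable_iff`).
In this form stability passes at once to invariant subspaces, quotients and extensions.

*Friends that stabilize the whole system.* Suppose `A` maps `V` into itself and is stable on it.
With `A' = A + 1/2`, let `V₀ = V` and let `V_{k+1}` consist of the states that `A'`, helped by some
input, moves into `V_k`. One feedback `F`, zero on `V`, moves each `V_{k+1}` into `V_k`, so on the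
limit `W` of the chain `A + B F` is annihilated by a stable polynomial. A dimension count gives
`im B ⊆ W`, so modulo `W` feedback is invisible and stabilizability of `(A, B)` says that `A` is
stable there (`exists_stabilizing_feedback`). The statement on input containing subspaces follows
by transposition (`isDetectabilityInputContaining_iff_dual`).

*Sufficiency.* In the coordinates plant state and estimation error, the closed loop with the
decoupling compensator is block triangular with diagonal blocks `A + B F` and `A + G C`, and
`V × S` is an invariant subspace that contains the effect of the disturbance and is annihilated by
the output. A transfer matrix vanishes iff its feedthrough does and there is such a subspace
(`transferMatrix_eq_zero_iff_exists_invariant`), which rests on comparing the recurrence of the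
Markov parameters with the one that Cayley–Hamilton provides.

*Necessity.* A solution has such a subspace `L`. Take for `V` the projection of `L` onto the plant
state, for `S` its intersection with the plant state space, and `K = D_c (I - D_y D_c)⁻¹`. That `V`
has a friend stable on it follows from the construction above, applied to the system restricted to
`V` with the inputs that respect `V`; it is stabilizable because `V` is an image of the stable
system on `L` (`exists_stable_friend_of_image`). The claim on `S` is the transposed one.
-/

/-! ### Stable polynomials -/

open Polynomial in
/-- A nonzero real polynomial all of whose complex roots lie in the stability region. -/
def IsStablePoly (T : TimeDomain) (p : ℝ[X]) : Prop :=
  p ≠ 0 ∧ ∀ z : ℂ, aeval z p = 0 → z ∈ T.stabilityRegion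

open Polynomial in
theorem IsStablePoly.mul {T : TimeDomain} {p q : ℝ[X]} (hp : IsStablePoly T p)
    (hq : IsStablePoly T q) : IsStablePoly T (p * q) := by
  refine ⟨mul_ne_zero hp.1 hq.1, fun z hz => ?_⟩
  rw [map_mul, mul_eq_zero] at hz
  exact hz.elim (hp.2 z) (hq.2 z)

open Polynomial in
theorem isStablePoly_one (T : TimeDomain) : IsStablePoly T 1 :=
  ⟨one_ne_zero, fun z hz => by simp at hz⟩

open Polynomial in
theorem IsStablePoly.pow {T : TimeDomain} {p : ℝ[X]} (hp : IsStablePoly T p) (k : ℕ) :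
    IsStablePoly T (p ^ k) := by
  induction k with
  | zero => simpa using isStablePoly_one T
  | succ k ih => rw [pow_succ]; exact ih.mul hp

open Polynomial in
/-- The point `-1/2` lies in both stability regions. -/
theorem isStablePoly_X_add_half (T : TimeDomain) : IsStablePoly T (X + C (1 / 2 : ℝ)) := by
  refine ⟨(monic_X_add_C _).ne_zero, fun z hz => ?_⟩
  have h : z = -(1 / 2 : ℂ) := by
    simp only [map_add, aeval_X, aeval_C, Complex.coe_algebraMap] at hz
    rw [eq_neg_iff_add_eq_zero, ← hz]
    push_cast
    rfl
  subst h
  cases T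
  · simp [TimeDomain.stabilityRegion]
  · simp only [TimeDomain.stabilityRegion, Set.mem_ofPred_eq, norm_neg]
    norm_num

open Polynomial in
/-- An endomorphism has its spectrum in the stability region iff a stable polynomial annihilates
it. This makes stability visibly inherited by invariant subspaces and quotients. -/
theorem endSpectrum_stable_iff (T : TimeDomain) {X : Type*} [AddCommGroup X] [Module ℝ X]
    [Module.Finite ℝ X] (f : Module.End ℝ X) :
    (∀ z ∈ endSpectrum f, z ∈ T.stabilityRegion) ↔
      ∃ p : ℝ[X], IsStablePoly T p ∧ aeval f p = 0 := by
  have hne : f.charpoly.map (algebraMap ℝ ℂ) ≠ 0 :=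
    (f.charpoly_monic.map _).ne_zero
  constructor
  · intro h
    refine ⟨f.charpoly, ⟨f.charpoly_monic.ne_zero, fun z hz => h z ?_⟩,
      LinearMap.aeval_self_charpoly f⟩
    rw [endSpectrum, mem_roots hne, IsRoot.def, eval_map_algebraMap]
    exact hz
  · rintro ⟨p, hp, hpf⟩ z hz
    apply hp.2
    rw [endSpectrum, mem_roots hne, ← LinearMap.charpoly_baseChange,
      ← Module.End.hasEigenvalue_iff_isRoot_charpoly] at hz
    obtain ⟨v, hv⟩ := hz.exists_hasEigenvector
    have h1 := Module.End.aeval_apply_of_hasEigenvector (p := p.map (algebraMap ℝ ℂ)) hv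
    have h2 : aeval (f.baseChange ℂ) (p.map (algebraMap ℝ ℂ)) = 0 := by
      rw [aeval_map_algebraMap]
      have := aeval_algHom_apply (Module.End.baseChangeHom ℝ ℂ X) f p
      rw [hpf, map_zero] at this
      exact this
    rw [h2, LinearMap.zero_apply, eval_map_algebraMap] at h1
    exact (smul_eq_zero.mp h1.symm).resolve_right hv.2

open Polynomial in
theorem isAsympStable_iff (T : TimeDomain) {ι : Type*} [Fintype ι] [DecidableEq ι]
    (M : Matrix ι ι ℝ) :
    IsAsympStable T M ↔ ∃ p : ℝ[X], IsStablePoly T p ∧ aeval M.mulVecLin p = 0 := by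
  rw [← endSpectrum_stable_iff, endSpectrum, Matrix.charpoly_mulVecLin]
  rfl

/-! ### Linear feedback on abstract spaces -/

section Abstract

variable {X Y U Z : Type*} [AddCommGroup X] [Module ℝ X] [AddCommGroup Y] [Module ℝ Y]
  [AddCommGroup U] [Module ℝ U] [AddCommGroup Z] [Module ℝ Z]

/-- If `π` intertwines `Φ` and `A` on the `Φ`-invariant subspace `L` modulo the `A`-invariant
subspace `N`, it intertwines all their polynomials in the same sense. -/
theorem aeval_intertwine {Φ : Module.End ℝ Y} {A : Module.End ℝ X} {π : Y →ₗ[ℝ] X}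
    {L : Submodule ℝ Y} {N : Submodule ℝ X} (hL : ∀ y ∈ L, Φ y ∈ L) (hN : ∀ x ∈ N, A x ∈ N)
    (h : ∀ y ∈ L, π (Φ y) - A (π y) ∈ N) (p : Polynomial ℝ) {y : Y} (hy : y ∈ L) :
    π (Polynomial.aeval Φ p y) - Polynomial.aeval A p (π y) ∈ N := by
  have hpow : ∀ (k : ℕ), (Φ ^ k) y ∈ L ∧ π ((Φ ^ k) y) - (A ^ k) (π y) ∈ N := by
    intro k
    induction k with
    | zero => simpa using hy
    | succ k ih =>
      rw [pow_succ', pow_succ', Module.End.mul_apply, Module.End.mul_apply]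
      refine ⟨hL _ ih.1, ?_⟩
      have := N.add_mem (h _ ih.1) (hN _ ih.2)
      rwa [map_sub, sub_add_sub_cancel] at this
  induction p using Polynomial.induction_on' with
  | add p q hp hq =>
    have := N.add_mem hp hq
    simp only [map_add, LinearMap.add_apply]
    convert this using 1
    abel
  | monomial k a =>
    have := N.smul_mem a (hpow k).2
    simp only [Polynomial.aeval_monomial, Module.algebraMap_end_eq_smul_id,
      LinearMap.smul_apply, LinearMap.id_apply, Module.End.mul_apply, map_smul]
    rwa [smul_sub] at this

/-- A linear relation that is total on a subspace contains the graph of a linear map over it. -/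
theorem exists_linear_selection (V : Submodule ℝ X) (R : Submodule ℝ (X × U))
    (h : ∀ x ∈ V, ∃ u, (x, u) ∈ R) : ∃ F : X →ₗ[ℝ] U, ∀ x ∈ V, (x, F x) ∈ R := by
  let π : R →ₗ[ℝ] X := LinearMap.fst ℝ X U ∘ₗ R.subtype
  obtain ⟨s, hs⟩ := π.rangeRestrict.exists_rightInverse_of_surjective π.range_rangeRestrict
  obtain ⟨F, hF⟩ := LinearMap.exists_extend (LinearMap.snd ℝ X U ∘ₗ R.subtype ∘ₗ s)
  refine ⟨F, fun x hx => ?_⟩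
  obtain ⟨u, hu⟩ := h x hx
  let x' : LinearMap.range π := ⟨x, ⟨⟨(x, u), hu⟩, rfl⟩⟩
  have h1 : F x = (s x' : X × U).2 := by
    have := LinearMap.congr_fun hF x'
    simpa using this
  have h2 : (s x' : X × U).1 = x := by
    exact congrArg Subtype.val (LinearMap.congr_fun hs x')
  rw [h1, ← h2]
  exact (s x').2

/-- One step of the controllability chain: the states that some input moves into `W`. -/
def controlPreimage (A : Module.End ℝ X) (B : U →ₗ[ℝ] X) (W : Submodule ℝ X) : Submodule ℝ X :=
  (W ⊔ LinearMap.range B).comap A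

theorem mem_controlPreimage {A : Module.End ℝ X} {B : U →ₗ[ℝ] X} {W : Submodule ℝ X} {x : X} :
    x ∈ controlPreimage A B W ↔ ∃ u, A x + B u ∈ W := by
  rw [controlPreimage, Submodule.mem_comap, Submodule.mem_sup]
  constructor
  · rintro ⟨w, hw, _, ⟨u, rfl⟩, h⟩
    refine ⟨-u, ?_⟩
    rw [← h]
    simpa using hw
  · rintro ⟨u, hu⟩
    exact ⟨_, hu, _, ⟨-u, rfl⟩, by simp⟩

theorem controlPreimage_mono (A : Module.End ℝ X) (B : U →ₗ[ℝ] X) :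
    Monotone (controlPreimage A B) :=
  fun _ _ h => Submodule.comap_mono (sup_le_sup_right h _)

theorem controlPreimage_iterate_mono {A : Module.End ℝ X} (B : U →ₗ[ℝ] X) {V : Submodule ℝ X}
    (hV : ∀ x ∈ V, A x ∈ V) : Monotone fun k => (controlPreimage A B)^[k] V := by
  refine (controlPreimage_mono A B).monotone_iterate_of_le_map fun x hx => ?_
  exact mem_controlPreimage.mpr ⟨0, by simpa using hV x hx⟩

/-- A single feedback moves every step of the chain into the preceding one: it is corrected on a
complement of each step in turn. -/
theorem exists_chain_feedback {A : Module.End ℝ X} (B : U →ₗ[ℝ] X) {V : Submodule ℝ X}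
    (hV : ∀ x ∈ V, A x ∈ V) (k : ℕ) :
    ∃ F : X →ₗ[ℝ] U, (∀ x ∈ V, F x = 0) ∧
      ∀ j < k, ∀ x ∈ (controlPreimage A B)^[j + 1] V,
        (A + B ∘ₗ F) x ∈ (controlPreimage A B)^[j] V := by
  have hmono := controlPreimage_iterate_mono B hV
  induction k with
  | zero => exact ⟨0, by simp, by simp⟩
  | succ k ih =>
    obtain ⟨F, hF0, hF⟩ := ih
    set Vk := (controlPreimage A B)^[k] V with hVk
    obtain ⟨g, hg⟩ := exists_linear_selection ((controlPreimage A B)^[k + 1] V)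
      (Vk.comap (A.coprod B)) (fun x hx => by
        rw [Function.iterate_succ_apply'] at hx
        obtain ⟨u, hu⟩ := mem_controlPreimage.mp hx
        exact ⟨u, by simpa using hu⟩)
    obtain ⟨P, hP⟩ := LinearMap.exists_extend (LinearMap.id : Vk →ₗ[ℝ] Vk)
    have hPx : ∀ x ∈ Vk, (P x : X) = x := fun x hx =>
      congrArg Subtype.val (LinearMap.congr_fun hP ⟨x, hx⟩)
    let Q : X →ₗ[ℝ] X := Vk.subtype ∘ₗ P
    have hQ : ∀ x ∈ Vk, Q x = x := hPx
    refine ⟨F ∘ₗ Q + g ∘ₗ (LinearMap.id - Q), fun x hx => ?_, fun j hj x hx => ?_⟩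
    · have : x ∈ Vk := hmono (Nat.zero_le k) hx
      simp [hQ x this, hF0 x hx]
    · rcases Nat.lt_succ_iff_lt_or_eq.mp hj with hj | rfl
      · have h1 : x ∈ Vk := hmono (Nat.succ_le_of_lt hj) hx
        have := hF j hj x hx
        simpa [hQ x h1] using this
      · have hQk : Q x ∈ Vk := (P x).2
        have h1 : (A + B ∘ₗ F) (Q x) ∈ Vk := by
          rcases j with _ | j
          · have h0 : A (Q x) + B (F (Q x)) ∈ V := by
              rw [hF0 _ hQk, map_zero, add_zero]
              exact hV _ hQk
            exact h0
          · exact hmono (Nat.le_succ j) (hF j (Nat.lt_succ_self j) _ hQk)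
        have h2 : x - Q x ∈ (controlPreimage A B)^[j + 1] V :=
          Submodule.sub_mem _ hx (hmono (Nat.le_succ j) hQk)
        have h3 := Vk.add_mem h1 (hg _ h2)
        simp only [LinearMap.coprod_apply, LinearMap.add_apply, LinearMap.comp_apply, map_sub,
          LinearMap.sub_apply, LinearMap.id_apply, map_add] at h3 ⊢
        convert h3 using 1
        abel

/-- A subspace that already contains every state from which it can be reached in one step contains
the image of `B`: the map `X / W → X / (W + im B)` induced by `A` is injective, so
`dim (W + im B) ≤ dim W`. -/
theorem range_le_of_controlPreimage_eq [FiniteDimensional ℝ X] {A : Module.End ℝ X}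
    {B : U →ₗ[ℝ] X} {W : Submodule ℝ X} (h : controlPreimage A B W = W) :
    LinearMap.range B ≤ W := by
  set W' := W ⊔ LinearMap.range B with hW'
  have hle : W ≤ W'.comap A := by rw [← controlPreimage, h]
  have hinj : Function.Injective (W.mapQ W' A hle) := by
    rw [← LinearMap.ker_eq_bot, Submodule.ker_mapQ]
    rw [← controlPreimage, h, ← LinearMap.le_ker_iff_map, Submodule.ker_mkQ]
  have h1 := LinearMap.finrank_le_finrank_of_injective hinj
  have h2 := W.finrank_quotient_add_finrank
  have h3 := W'.finrank_quotient_add_finrank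
  have h4 : W = W' := Submodule.eq_of_le_of_finrank_le le_sup_left (by omega)
  rw [h4]
  exact le_sup_right

open Polynomial in
/-- Stabilization relative to an invariant subspace `V` on which `A` is already stable. If `A` is
stable modulo every invariant subspace containing `V` and `im B`, a feedback vanishing on `V`
stabilizes `A`. -/
theorem exists_stabilizing_feedback [FiniteDimensional ℝ X] (T : TimeDomain)
    {A : Module.End ℝ X} {B : U →ₗ[ℝ] X} {V : Submodule ℝ X} (hV : ∀ x ∈ V, A x ∈ V)
    (hVs : ∃ p : ℝ[X], IsStablePoly T p ∧ ∀ x ∈ V, aeval A p x = 0)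
    (hAB : ∀ N : Submodule ℝ X, V ≤ N → (∀ x ∈ N, A x ∈ N) → LinearMap.range B ≤ N →
      ∃ q : ℝ[X], IsStablePoly T q ∧ ∀ x, aeval A q x ∈ N) :
    ∃ F : X →ₗ[ℝ] U, (∀ x ∈ V, F x = 0) ∧
      ∃ p : ℝ[X], IsStablePoly T p ∧ aeval (A + B ∘ₗ F) p = 0 := by
  set A' : Module.End ℝ X := A + algebraMap ℝ _ (1 / 2) with hA'
  have hA'x : ∀ x, A' x = A x + (1 / 2 : ℝ) • x := fun x => by
    simp [hA', Module.algebraMap_end_apply]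
  have hV' : ∀ x ∈ V, A' x ∈ V := fun x hx => by
    rw [hA'x]; exact V.add_mem (hV x hx) (V.smul_mem _ hx)
  have hmono := controlPreimage_iterate_mono B hV'
  obtain ⟨k, hk⟩ := monotone_stabilizes_iff_noetherian.mpr (inferInstance : IsNoetherian ℝ X)
    ⟨_, hmono⟩
  set W := (controlPreimage A' B)^[k] V with hW
  have hfix : controlPreimage A' B W = W := by
    have := hk (k + 1) (Nat.le_succ k)
    simp only [OrderHom.coe_mk, Function.iterate_succ_apply'] at this
    exact this.symm
  have hBW := range_le_of_controlPreimage_eq hfix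
  have hVW : V ≤ W := hmono (Nat.zero_le k)
  have hAW : ∀ x ∈ W, A x ∈ W := fun x hx => by
    rw [← hfix, mem_controlPreimage] at hx
    obtain ⟨u, hu⟩ := hx
    have h1 := W.sub_mem hu (hBW ⟨u, rfl⟩)
    rw [add_sub_cancel_right, hA'x] at h1
    have hxW : x ∈ W := by rw [← hfix]; exact mem_controlPreimage.mpr ⟨u, hu⟩
    simpa using W.sub_mem h1 (W.smul_mem (1 / 2 : ℝ) hxW)
  obtain ⟨F, hF0, hF⟩ := exists_chain_feedback B hV' k
  obtain ⟨p, hp, hpV⟩ := hVs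
  obtain ⟨q, hq, hqW⟩ := hAB W hVW hAW hBW
  have hchain : ∀ j ≤ k, ∀ x ∈ (controlPreimage A' B)^[j] V, ((A' + B ∘ₗ F) ^ j) x ∈ V := by
    intro j
    induction j with
    | zero => intro _ x hx; simpa using hx
    | succ j ih =>
      intro hj x hx
      rw [pow_succ, Module.End.mul_apply]
      exact ih (by omega) _ (hF j (by omega) x hx)
  refine ⟨F, hF0, p * ((Polynomial.X + C (1 / 2 : ℝ)) ^ k * q),
    hp.mul (((isStablePoly_X_add_half T).pow k).mul hq), LinearMap.ext fun x => ?_⟩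
  have h1 : aeval (A + B ∘ₗ F) q x ∈ W := by
    have := aeval_intertwine (Φ := A + B ∘ₗ F) (A := A) (π := LinearMap.id) (L := ⊤) (N := W)
      (fun _ _ => trivial) hAW (fun y _ => by simpa using hBW ⟨F y, rfl⟩) q
      (Submodule.mem_top (x := x))
    simpa using W.add_mem this (hqW x)
  have h2 : aeval (A + B ∘ₗ F) ((Polynomial.X + C (1 / 2 : ℝ)) ^ k) (aeval (A + B ∘ₗ F) q x) ∈ V := by
    have h := hchain k le_rfl _ h1
    rw [map_pow, map_add, aeval_X, aeval_C, add_right_comm]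
    exact h
  have h3 : ∀ v ∈ V, aeval (A + B ∘ₗ F) p v = 0 := fun v hv => by
    have := aeval_intertwine (Φ := A) (A := A + B ∘ₗ F) (π := LinearMap.id) (L := V) (N := ⊥)
      hV (by simp) (fun y hy => by simp [hF0 y hy]) p hv
    simpa [hpV v hv] using this
  rw [map_mul, map_mul, Module.End.mul_apply, Module.End.mul_apply, h3 _ h2, LinearMap.zero_apply]

open Polynomial in
/-- If a feedback stabilizes `A`, then `A` is stable modulo every invariant subspace containing
`im B`, since the feedback is invisible there. -/
theorem stable_mod_of_stabilizable {T : TimeDomain} {A : Module.End ℝ X} {B : U →ₗ[ℝ] X}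
    {F : X →ₗ[ℝ] U} (h : ∃ p : ℝ[X], IsStablePoly T p ∧ aeval (A + B ∘ₗ F) p = 0)
    {N : Submodule ℝ X} (hN : ∀ x ∈ N, A x ∈ N) (hB : LinearMap.range B ≤ N) :
    ∃ q : ℝ[X], IsStablePoly T q ∧ ∀ x, aeval A q x ∈ N := by
  obtain ⟨p, hp, hp0⟩ := h
  refine ⟨p, hp, fun x => ?_⟩
  have := aeval_intertwine (Φ := A + B ∘ₗ F) (A := A) (π := LinearMap.id) (L := ⊤) (N := N)
    (fun _ _ => trivial) hN (fun y _ => by simpa using hB ⟨F y, rfl⟩) p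
    (Submodule.mem_top (x := x))
  simpa [hp0] using this

open Polynomial in
/-- A subspace `π L` that is the image of an invariant subspace of a stable system `Φ` carrying an
input signal `κ` has a friend that is stable on it. The part of `κ` not explained by a first friend
uses only inputs that keep `π L` invariant and leave the output unaffected, and the pair of the
restricted system with these inputs is stabilizable: modulo an invariant subspace containing the
images of these inputs, `π` intertwines it with `Φ`. -/
theorem exists_stable_friend_of_image [FiniteDimensional ℝ X] {T : TimeDomain}
    {A : Module.End ℝ X} {B : U →ₗ[ℝ] X} {E : X →ₗ[ℝ] Z} {D : U →ₗ[ℝ] Z}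
    {Φ : Module.End ℝ Y} {π : Y →ₗ[ℝ] X} {κ : Y →ₗ[ℝ] U} {L : Submodule ℝ Y}
    (hL : ∀ y ∈ L, Φ y ∈ L) (hΦ : ∃ q : ℝ[X], IsStablePoly T q ∧ aeval Φ q = 0)
    (hA : ∀ y ∈ L, A (π y) + B (κ y) = π (Φ y)) (hE : ∀ y ∈ L, E (π y) + D (κ y) = 0) :
    ∃ F : X →ₗ[ℝ] U,
      (∀ x ∈ L.map π, (A + B ∘ₗ F) x ∈ L.map π ∧ (E + D ∘ₗ F) x = 0) ∧
      ∃ p : ℝ[X], IsStablePoly T p ∧ ∀ x ∈ L.map π, aeval (A + B ∘ₗ F) p x = 0 := by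
  set V := L.map π with hV
  obtain ⟨q, hq, hq0⟩ := hΦ
  obtain ⟨F₀, hF₀⟩ := exists_linear_selection V
    (V.comap (A.coprod B) ⊓ LinearMap.ker (E.coprod D)) (by
      rintro _ ⟨y, hy, rfl⟩
      exact ⟨κ y, ⟨_, hL y hy, (hA y hy).symm⟩, by simpa using hE y hy⟩)
  have hF₀V : ∀ x ∈ V, (A + B ∘ₗ F₀) x ∈ V := fun x hx => (hF₀ x hx).1
  have hF₀E : ∀ x ∈ V, E x + D (F₀ x) = 0 := fun x hx => by simpa using (hF₀ x hx).2
  let A₀ : Module.End ℝ V := (A + B ∘ₗ F₀).restrict hF₀V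
  let U₀ : Submodule ℝ U := V.comap B ⊓ LinearMap.ker D
  let B₀ : U₀ →ₗ[ℝ] V := (B ∘ₗ U₀.subtype).codRestrict V fun u => u.2.1
  obtain ⟨F₁, -, p, hp, hp0⟩ := exists_stabilizing_feedback (X := V) T (A := A₀) (B := B₀)
    (V := ⊥) (by simp) ⟨1, isStablePoly_one T, by simp⟩ (by
      intro N _ hN hB
      refine ⟨q, hq, ?_⟩
      rintro ⟨_, y, hy, rfl⟩
      let π' : L →ₗ[ℝ] V := (π ∘ₗ L.subtype).codRestrict V fun y => ⟨_, y.2, rfl⟩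
      have h1 := aeval_intertwine (Φ := Φ.restrict hL) (A := A₀) (π := π') (L := ⊤) (N := N)
        (fun _ _ => trivial) hN (by
          rintro ⟨y, hy⟩ -
          have hu : κ y - F₀ (π y) ∈ U₀ := by
            have hy' : π y ∈ V := ⟨y, hy, rfl⟩
            constructor
            · have h2 := V.sub_mem (show π (Φ y) ∈ V from ⟨_, hL y hy, rfl⟩) (hF₀V _ hy')
              rw [← hA y hy] at h2
              simpa using h2
            · have h2 := hE y hy
              rw [← hF₀E _ hy'] at h2
              simpa [sub_eq_zero] using h2
          refine (congrArg (· ∈ N) (Subtype.ext ?_)).mp (hB ⟨⟨_, hu⟩, rfl⟩)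
          change B (κ y - F₀ (π y)) = π (Φ y) - (A (π y) + B (F₀ (π y)))
          rw [← hA y hy, map_sub]
          abel) q (Submodule.mem_top (x := ⟨y, hy⟩))
      have h2 := aeval_intertwine (Φ := Φ.restrict hL) (A := Φ) (π := L.subtype) (L := ⊤)
        (N := ⊥) (fun _ _ => trivial) (by simp) (fun _ _ => by simp) q
        (Submodule.mem_top (x := ⟨y, hy⟩))
      have h3 : aeval (Φ.restrict hL) q ⟨y, hy⟩ = 0 := by
        rw [Submodule.mem_bot, hq0] at h2
        simpa using h2
      rw [h3, map_zero, zero_sub] at h1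
      exact N.neg_mem_iff.mp h1)
  obtain ⟨F₂, hF₂⟩ := LinearMap.exists_extend (U₀.subtype ∘ₗ F₁)
  have hF₂' : ∀ x : V, F₂ x = F₁ x := fun x => LinearMap.congr_fun hF₂ x
  have hint : ∀ x : V, (A + B ∘ₗ (F₀ + F₂)) x = ((A₀ + B₀ ∘ₗ F₁) x : V) := fun x => by
    change A x + B (F₀ x + F₂ x) = (A x + B (F₀ x)) + B (F₁ x)
    rw [hF₂', map_add, add_assoc]
  refine ⟨F₀ + F₂, fun x hx => ⟨?_, ?_⟩, p, hp, fun x hx => ?_⟩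
  · rw [hint ⟨x, hx⟩]
    exact Subtype.coe_prop _
  · have h1 : D (F₁ ⟨x, hx⟩) = 0 := (F₁ ⟨x, hx⟩).2.2
    have h2 := hF₂' ⟨x, hx⟩
    have h3 := hF₀E x hx
    simp only at h2
    simp [h2, h1, h3]
  · have := aeval_intertwine (Φ := A₀ + B₀ ∘ₗ F₁) (A := A + B ∘ₗ (F₀ + F₂)) (π := V.subtype)
      (L := ⊤) (N := ⊥) (fun _ _ => trivial) (by simp)
      (fun y _ => by rw [Submodule.mem_bot, sub_eq_zero]; exact (hint y).symm) p
      (Submodule.mem_top (x := ⟨x, hx⟩))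
    simpa [hp0] using this

end Abstract

/-! ### Transfer matrices and Markov parameters -/

section Transfer

open Polynomial

/-- Here `y k` is the polynomial `-(d X ^ k + ∑ i < k, m i X ^ (k - 1 - i))`, of degree exactly `k`
unless `d = 0`. A monic linear recurrence forces its leading coefficient to vanish, and then
shifting the sequence does the same for each `m i`. -/
theorem eq_zero_of_recurrence {χ : ℝ[X]} (hχ : χ.Monic) {m : ℕ → ℝ} {y : ℕ → ℝ[X]} {d : ℝ}
    (h0 : y 0 = C d) (hy : ∀ k, y (k + 1) = X * y k - C (m k))
    (hrec : ∀ j, ∑ i ∈ Finset.range (χ.natDegree + 1), C (χ.coeff i) * y (i + j) = 0) (k : ℕ) :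
    y k = 0 := by
  have key : ∀ (m : ℕ → ℝ) (y : ℕ → ℝ[X]) (d : ℝ), y 0 = C d →
      (∀ k, y (k + 1) = X * y k - C (m k)) →
      ∑ i ∈ Finset.range (χ.natDegree + 1), C (χ.coeff i) * y i = 0 → d = 0 := by
    intro m y d h0 hy hrec
    have hc : ∀ k, (y k).coeff k = d ∧ ∀ i, k < i → (y k).coeff i = 0 := by
      intro k
      induction k with
      | zero =>
        rw [h0]
        exact ⟨coeff_C_zero, fun i hi => coeff_C_of_ne_zero (by omega)⟩
      | succ k ih =>
        have hs : ∀ i, (y (k + 1)).coeff (i + 1) = (y k).coeff i := fun i => by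
          rw [hy, coeff_sub, coeff_X_mul, coeff_C_succ, sub_zero]
        refine ⟨by rw [hs, ih.1], fun i hi => ?_⟩
        obtain ⟨i, rfl⟩ : ∃ i', i = i' + 1 := ⟨i - 1, by omega⟩
        rw [hs, ih.2 i (by omega)]
    have h := congrArg (fun p => p.coeff χ.natDegree) hrec
    simp only [finsetSum_coeff, coeff_C_mul, coeff_zero] at h
    rw [Finset.sum_range_succ, Finset.sum_eq_zero, zero_add, (hc _).1, hχ.coeff_natDegree,
      one_mul] at h
    · exact h
    · intro i hi
      rw [(hc i).2 _ (Finset.mem_range.mp hi), mul_zero]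
  induction k with
  | zero => rw [h0, key m y d h0 hy (hrec 0), C_0]
  | succ k ih =>
    have h1 : y (k + 1) = C (-m k) := by rw [hy, ih]; simp
    rw [h1, key (fun i => m (i + (k + 1))) (fun i => y (i + (k + 1))) (-m k)
      (by simpa using h1) (fun i => ?_) (hrec (k + 1)), C_0]
    rw [← hy, add_right_comm]

variable {ι κ o : Type*} [Fintype ι] [DecidableEq ι]

/-- The transfer matrix vanishes iff the feedthrough and all Markov parameters `C A ^ k B` do. The
matrices `Y k = C A ^ k (X - A)⁻¹ B` satisfy `Y (k + 1) = X Y k - C A ^ k B`, and by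
Cayley–Hamilton also the recurrence of the characteristic polynomial. -/
theorem transferMatrix_eq_zero_iff (A : Matrix ι ι ℝ) (B : Matrix ι κ ℝ) (C : Matrix o ι ℝ)
    (D : Matrix o κ ℝ) :
    transferMatrix A B C D = 0 ↔ D = 0 ∧ ∀ k : ℕ, C * A ^ k * B = 0 := by
  set A' := A.map (RatFunc.C (K := ℝ)) with hA'
  set R : Matrix ι ι (RatFunc ℝ) := (RatFunc.X : RatFunc ℝ) • (1 : Matrix ι ι (RatFunc ℝ)) - A'
    with hR
  have hRmap : R = (algebraMap ℝ[X] (RatFunc ℝ)).mapMatrix A.charmatrix := by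
    ext i j
    by_cases hij : i = j
    · subst hij; simp [hR, hA']
    · simp [hR, hA', hij]
  have hdet : R.det = algebraMap ℝ[X] (RatFunc ℝ) A.charpoly := by
    rw [hRmap, ← RingHom.map_det]; rfl
  have hunit : IsUnit R.det := by
    rw [hdet]
    exact ((map_ne_zero_iff _ (IsFractionRing.injective ℝ[X] (RatFunc ℝ))).mpr
      A.charpoly_monic.ne_zero).isUnit
  have hRinv : A' * R⁻¹ = (RatFunc.X : RatFunc ℝ) • R⁻¹ - 1 := by
    have h := Matrix.mul_nonsing_inv R hunit
    nth_rewrite 1 [hR] at h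
    rw [sub_mul, smul_mul_assoc, one_mul] at h
    rw [← h]; abel
  have hpow : ∀ k, A' ^ k = (A ^ k).map (RatFunc.C (K := ℝ)) := fun k =>
    (map_pow (RatFunc.C (K := ℝ)).mapMatrix A k).symm
  set B' := B.map (RatFunc.C (K := ℝ))
  set C' := C.map (RatFunc.C (K := ℝ))
  let Y : ℕ → Matrix o κ (RatFunc ℝ) := fun k => C' * A' ^ k * R⁻¹ * B'
  have hY : ∀ k, Y (k + 1) = (RatFunc.X : RatFunc ℝ) • Y k
      - (C * A ^ k * B).map (RatFunc.C (K := ℝ)) := fun k => by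
    have : C' * A' ^ (k + 1) * R⁻¹ * B' = C' * A' ^ k * (A' * R⁻¹) * B' := by
      rw [pow_succ]; simp only [Matrix.mul_assoc]
    simp only [Y]
    rw [this, hRinv, Matrix.map_mul, Matrix.map_mul, ← hpow]
    simp [Matrix.mul_sub, Matrix.sub_mul, B', C']
  have hCH : ∀ j, ∑ i ∈ Finset.range (A.charpoly.natDegree + 1),
      RatFunc.C (A.charpoly.coeff i) • Y (i + j) = 0 := fun j => by
    have h := Matrix.aeval_self_charpoly A
    rw [aeval_eq_sum_range] at h
    have h' := congrArg (RatFunc.C (K := ℝ)).mapMatrix h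
    rw [map_sum, map_zero] at h'
    have h'' : ∑ i ∈ Finset.range (A.charpoly.natDegree + 1),
        RatFunc.C (A.charpoly.coeff i) • A' ^ i = 0 := by
      rw [← h']
      refine Finset.sum_congr rfl fun i _ => ?_
      rw [hpow]
      ext a b
      simp
    have : ∀ i, RatFunc.C (A.charpoly.coeff i) • Y (i + j) =
        C' * (RatFunc.C (A.charpoly.coeff i) • A' ^ i) * (A' ^ j * R⁻¹ * B') := fun i => by
      simp only [Y, pow_add, Matrix.mul_assoc, Matrix.mul_smul, Matrix.smul_mul]
    simp only [this]
    rw [← Matrix.sum_mul, ← Matrix.mul_sum, h'', Matrix.mul_zero, Matrix.zero_mul]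
  have hT : transferMatrix A B C D = Y 0 + D.map (RatFunc.C (K := ℝ)) := by
    simp [transferMatrix, Y, B', C', R, A']
  rw [hT]
  obtain ⟨m, hm⟩ : ∃ m : ℕ → Matrix o κ ℝ, ∀ k, C * A ^ k * B = m k := ⟨_, fun _ => rfl⟩
  simp only [hm] at hY ⊢
  have hinj := IsFractionRing.injective ℝ[X] (RatFunc ℝ)
  constructor
  · intro h0
    have hent : ∀ a b, ∀ k, ∃ p : ℝ[X], algebraMap ℝ[X] (RatFunc ℝ) p = Y k a b := by
      intro a b k
      induction k with
      | zero =>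
        refine ⟨-Polynomial.C (D a b), ?_⟩
        have := congrFun (congrFun h0 a) b
        rw [map_neg, RatFunc.algebraMap_C, neg_eq_iff_add_eq_zero, add_comm]
        simpa using this
      | succ k ih =>
        obtain ⟨p, hp⟩ := ih
        refine ⟨X * p - Polynomial.C (m k a b), ?_⟩
        rw [hY]
        simp [hp]
    have hzero : ∀ a b, D a b = 0 ∧ ∀ k, m k a b = 0 := by
      intro a b
      choose p hp using hent a b
      have hp0 : p 0 = Polynomial.C (-D a b) := hinj <| by
        rw [hp, C_neg, map_neg, RatFunc.algebraMap_C]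
        have := congrFun (congrFun h0 a) b
        exact eq_neg_of_add_eq_zero_left (by simpa using this)
      have hps : ∀ k, p (k + 1) = X * p k - Polynomial.C (m k a b) := fun k =>
        hinj <| by rw [hp, hY]; simp [hp]
      have hz := eq_zero_of_recurrence A.charpoly_monic hp0 hps (fun j => hinj <| by
        have := congrFun (congrFun (hCH j) a) b
        rw [map_sum, map_zero]
        simp only [Matrix.sum_apply, Matrix.smul_apply, smul_eq_mul, Matrix.zero_apply] at this
        simpa [hp] using this)
      refine ⟨by simpa [hz 0] using hp0, fun k => ?_⟩
      have := hps k
      rw [hz, hz, mul_zero, zero_sub, eq_comm, neg_eq_zero, C_eq_zero] at this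
      exact this
    exact ⟨Matrix.ext fun a b => (hzero a b).1, fun k => Matrix.ext fun a b => (hzero a b).2 k⟩
  · rintro ⟨hD, hM⟩
    have hYk : ∀ k, Y k = (RatFunc.X : RatFunc ℝ) ^ k • Y 0 := fun k => by
      induction k with
      | zero => simp
      | succ k ih =>
        rw [hY, hM, ih, smul_smul, pow_succ']
        ext a b
        simp
    have h : (∑ i ∈ Finset.range (A.charpoly.natDegree + 1),
        RatFunc.C (A.charpoly.coeff i) * (RatFunc.X : RatFunc ℝ) ^ i) • Y 0 = 0 := by
      rw [Finset.sum_smul, ← hCH 0]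
      refine Finset.sum_congr rfl fun i _ => ?_
      rw [add_zero, hYk i, smul_smul]
    have hχ : ∑ i ∈ Finset.range (A.charpoly.natDegree + 1),
        RatFunc.C (A.charpoly.coeff i) * (RatFunc.X : RatFunc ℝ) ^ i =
        algebraMap ℝ[X] (RatFunc ℝ) A.charpoly := by
      conv_rhs => rw [A.charpoly.as_sum_range_C_mul_X_pow]
      rw [map_sum]
      refine Finset.sum_congr rfl fun i _ => ?_
      rw [map_mul, map_pow, RatFunc.algebraMap_C, RatFunc.algebraMap_X]
    rw [hχ, smul_eq_zero] at h
    have h0 : Y 0 = 0 := h.resolve_left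
      ((map_ne_zero_iff _ hinj).mpr A.charpoly_monic.ne_zero)
    rw [h0, hD]
    ext a b
    simp

/-- The transfer matrix vanishes iff the feedthrough does and some invariant subspace lies between
the image of the input matrix and the kernel of the output matrix; the unobservable subspace is
one. -/
theorem transferMatrix_eq_zero_iff_exists_invariant [Fintype κ] (A : Matrix ι ι ℝ)
    (B : Matrix ι κ ℝ) (C : Matrix o ι ℝ) (D : Matrix o κ ℝ) :
    transferMatrix A B C D = 0 ↔ D = 0 ∧ ∃ L : Submodule ℝ (ι → ℝ),
      (∀ v ∈ L, A *ᵥ v ∈ L) ∧ (∀ w, B *ᵥ w ∈ L) ∧ ∀ v ∈ L, C *ᵥ v = 0 := by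
  rw [transferMatrix_eq_zero_iff]
  refine and_congr_right fun _ => ⟨fun h => ?_, ?_⟩
  · refine ⟨⨅ k : ℕ, LinearMap.ker (C * A ^ k).mulVecLin, fun v hv => ?_, fun w => ?_,
      fun v hv => ?_⟩
    · simp only [Submodule.mem_iInf, LinearMap.mem_ker, Matrix.mulVecLin_apply] at hv ⊢
      intro k
      rw [Matrix.mulVec_mulVec, Matrix.mul_assoc, ← pow_succ]
      exact hv (k + 1)
    · simp only [Submodule.mem_iInf, LinearMap.mem_ker, Matrix.mulVecLin_apply]
      intro k
      rw [Matrix.mulVec_mulVec, h, Matrix.zero_mulVec]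
    · simp only [Submodule.mem_iInf, LinearMap.mem_ker, Matrix.mulVecLin_apply] at hv
      simpa using hv 0
  · rintro ⟨L, hA, hB, hC⟩ k
    have hpow : ∀ k : ℕ, ∀ v ∈ L, (A ^ k) *ᵥ v ∈ L := fun k => by
      induction k with
      | zero => simp
      | succ k ih =>
        intro v hv
        rw [pow_succ, ← Matrix.mulVec_mulVec]
        exact ih _ (hA v hv)
    classical
    refine Matrix.ext_of_mulVec_single fun j => ?_
    rw [← Matrix.mulVec_mulVec, ← Matrix.mulVec_mulVec, hC _ (hpow k _ (hB _)),
      Matrix.zero_mulVec]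

end Transfer

/-! ### Transposition duality -/

section Dual

open Polynomial

variable {ι κ : Type*} [Fintype ι] [Fintype κ]

/-- The orthogonal complement with respect to the dot product. -/
def dotPerp (S : Submodule ℝ (ι → ℝ)) : Submodule ℝ (ι → ℝ) where
  carrier := {y | ∀ x ∈ S, y ⬝ᵥ x = 0}
  zero_mem' := fun x _ => zero_dotProduct x
  add_mem' := fun {a b} ha hb x hx => by rw [add_dotProduct, ha x hx, hb x hx, add_zero]
  smul_mem' := fun c a ha x hx => by rw [smul_dotProduct, ha x hx, smul_zero]

theorem mem_dotPerp {S : Submodule ℝ (ι → ℝ)} {y : ι → ℝ} :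
    y ∈ dotPerp S ↔ ∀ x ∈ S, y ⬝ᵥ x = 0 := Iff.rfl

theorem dotPerp_dotPerp (S : Submodule ℝ (ι → ℝ)) : dotPerp (dotPerp S) = S := by
  classical
  refine le_antisymm (fun v hv => ?_) fun x hx => mem_dotPerp.mpr fun y hy => ?_
  · by_contra hvS
    obtain ⟨f, hfv, hSf⟩ := S.exists_le_ker_of_notMem hvS
    obtain ⟨y, rfl⟩ := (dotProductEquiv ℝ ι).surjective f
    have hf : ∀ x, y ⬝ᵥ x = dotProductEquiv ℝ ι y x := fun _ => rfl
    apply hfv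
    rw [← hf, dotProduct_comm]
    exact hv _ fun x hx => (hf x).trans (hSf hx)
  · rw [dotProduct_comm]
    exact hy x hx

theorem dotProduct_mulVec_transpose (M : Matrix ι κ ℝ) (y : ι → ℝ) (x : κ → ℝ) :
    y ⬝ᵥ (M *ᵥ x) = (Mᵀ *ᵥ y) ⬝ᵥ x := by
  rw [Matrix.dotProduct_mulVec, Matrix.mulVec_transpose]

theorem dotProduct_aeval_transpose (M : Matrix ι ι ℝ) (p : ℝ[X]) (y x : ι → ℝ) :
    y ⬝ᵥ (aeval M.mulVecLin p x) = (aeval Mᵀ.mulVecLin p y) ⬝ᵥ x := by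
  have hpow : ∀ (k : ℕ) (y x : ι → ℝ),
      y ⬝ᵥ ((M.mulVecLin ^ k) x) = ((Mᵀ.mulVecLin ^ k) y) ⬝ᵥ x := by
    intro k
    induction k with
    | zero => simp
    | succ k ih =>
      intro y x
      rw [pow_succ, Module.End.mul_apply, ih, pow_succ', Module.End.mul_apply,
        Matrix.mulVecLin_apply, Matrix.mulVecLin_apply, dotProduct_mulVec_transpose]
  induction p using Polynomial.induction_on' with
  | add p q hp hq => simp [dotProduct_add, add_dotProduct, hp, hq]
  | monomial k a =>
    simp only [aeval_monomial, Module.algebraMap_end_eq_smul_id, LinearMap.smul_apply,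
      LinearMap.id_apply, Module.End.mul_apply, dotProduct_smul, smul_dotProduct, hpow]

theorem isAsympStable_transpose (T : TimeDomain) [DecidableEq ι] (M : Matrix ι ι ℝ) :
    IsAsympStable T Mᵀ ↔ IsAsympStable T M := by
  simp only [IsAsympStable, matSpectrum, Matrix.charpoly_transpose]

end Dual

/-! ### Friends of subspaces -/

section Friends

open Polynomial

variable {n m p q : ℕ} {A : Matrix (Fin n) (Fin n) ℝ} {B : Matrix (Fin n) (Fin m) ℝ}
  {C : Matrix (Fin p) (Fin n) ℝ} {D : Matrix (Fin p) (Fin m) ℝ}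
  {V S : Submodule ℝ (Fin n → ℝ)}

theorem isOutputNullingFriend_iff {F : Matrix (Fin m) (Fin n) ℝ} :
    IsOutputNullingFriend A B C D V F ↔
      ∀ x ∈ V, (A + B * F) *ᵥ x ∈ V ∧ (C + D * F) *ᵥ x = 0 := by
  rw [IsOutputNullingFriend, Submodule.map_le_iff_le_comap]
  exact Iff.rfl

theorem isInputContainingFriend_iff {G : Matrix (Fin n) (Fin p) ℝ} :
    IsInputContainingFriend A B C D S G ↔
      ∀ x ∈ S, ∀ w, (A + G * C) *ᵥ x + (B + G * D) *ᵥ w ∈ S := by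
  rw [IsInputContainingFriend, Submodule.map_le_iff_le_comap]
  exact ⟨fun h x hx w => h (x := (x, w)) ⟨hx, trivial⟩, fun h x hx => h x.1 hx.1 x.2⟩

theorem IsOutputNullingFriend.isOutputNulling {F : Matrix (Fin m) (Fin n) ℝ}
    (h : IsOutputNullingFriend A B C D V F) : IsOutputNulling A B C D V := by
  rw [isOutputNullingFriend_iff] at h
  rintro _ ⟨x, hx, rfl⟩
  refine Submodule.mem_sup.mpr ⟨((A + B * F) *ᵥ x, (C + D * F) *ᵥ x), h x hx, _,
    ⟨-(F *ᵥ x), rfl⟩, ?_⟩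
  ext <;> simp [Matrix.add_mulVec, Matrix.mulVec_neg]

theorem IsInputContainingFriend.isInputContaining {G : Matrix (Fin n) (Fin p) ℝ}
    (h : IsInputContainingFriend A B C D S G) : IsInputContaining A B C D S := by
  rw [isInputContainingFriend_iff] at h
  rintro _ ⟨⟨x, w⟩, ⟨⟨hx, -⟩, hxw⟩, rfl⟩
  have hxw' : C *ᵥ x + D *ᵥ w = 0 := hxw
  have h1 := h x hx w
  have h2 : (A + G * C) *ᵥ x + (B + G * D) *ᵥ w =
      A *ᵥ x + B *ᵥ w + G *ᵥ (C *ᵥ x + D *ᵥ w) := by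
    simp only [Matrix.add_mulVec, Matrix.mulVec_add, Matrix.mulVec_mulVec]
    abel
  rw [h2, hxw', Matrix.mulVec_zero, add_zero] at h1
  exact h1

theorem isStabilizabilityOutputNulling_iff {T : TimeDomain} :
    IsStabilizabilityOutputNulling A B C D T V ↔
      ∃ F : Matrix (Fin m) (Fin n) ℝ, IsOutputNullingFriend A B C D V F ∧
        ∃ f : ℝ[X], IsStablePoly T f ∧ ∀ x ∈ V, aeval (A + B * F).mulVecLin f x = 0 := by
  have key : ∀ (F : Matrix (Fin m) (Fin n) ℝ) (hF : IsOutputNullingFriend A B C D V F)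
      (f : ℝ[X]) (x : V), ((aeval ((A + B * F).mulVecLin.restrict hF.mapsTo) f x : V) : Fin n → ℝ) =
        aeval (A + B * F).mulVecLin f x := fun F hF f x => by
    have := aeval_intertwine (Φ := (A + B * F).mulVecLin.restrict hF.mapsTo)
      (A := (A + B * F).mulVecLin) (π := V.subtype) (L := ⊤) (N := ⊥) (fun _ _ => trivial)
      (by simp) (fun y _ => by simp) f (Submodule.mem_top (x := x))
    exact sub_eq_zero.mp this
  constructor
  · rintro ⟨-, F, hF, hs⟩
    obtain ⟨f, hf, hf0⟩ := (endSpectrum_stable_iff T _).mp hs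
    refine ⟨F, hF, f, hf, fun x hx => ?_⟩
    rw [← key F hF f ⟨x, hx⟩, hf0]
    rfl
  · rintro ⟨F, hF, f, hf, hf0⟩
    refine ⟨hF.isOutputNulling, F, hF, (endSpectrum_stable_iff T _).mpr ⟨f, hf, ?_⟩⟩
    refine LinearMap.ext fun x => Subtype.ext ?_
    rw [key F hF, hf0 x x.2]
    rfl

theorem isDetectabilityInputContaining_iff {T : TimeDomain} :
    IsDetectabilityInputContaining A B C D T S ↔
      ∃ G : Matrix (Fin n) (Fin p) ℝ, IsInputContainingFriend A B C D S G ∧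
        ∃ f : ℝ[X], IsStablePoly T f ∧ ∀ x, aeval (A + G * C).mulVecLin f x ∈ S := by
  have key : ∀ (G : Matrix (Fin n) (Fin p) ℝ) (hG : IsInputContainingFriend A B C D S G)
      (f : ℝ[X]) (x : Fin n → ℝ), S.mkQ (aeval (A + G * C).mulVecLin f x) =
        aeval (S.mapQ S (A + G * C).mulVecLin hG.le_comap) f (S.mkQ x) := fun G hG f x => by
    have := aeval_intertwine (Φ := (A + G * C).mulVecLin)
      (A := S.mapQ S (A + G * C).mulVecLin hG.le_comap) (π := S.mkQ) (L := ⊤) (N := ⊥)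
      (fun _ _ => trivial) (by simp) (fun y _ => by simp) f (Submodule.mem_top (x := x))
    exact sub_eq_zero.mp this
  constructor
  · rintro ⟨-, G, hG, hs⟩
    obtain ⟨f, hf, hf0⟩ := (endSpectrum_stable_iff T _).mp hs
    refine ⟨G, hG, f, hf, fun x => ?_⟩
    rw [← S.ker_mkQ, LinearMap.mem_ker, key G hG, hf0]
    rfl
  · rintro ⟨G, hG, f, hf, hf0⟩
    refine ⟨hG.isInputContaining, G, hG, (endSpectrum_stable_iff T _).mpr ⟨f, hf, ?_⟩⟩
    refine LinearMap.ext fun x => ?_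
    obtain ⟨x, rfl⟩ := S.mkQ_surjective x
    rw [← key G hG, LinearMap.zero_apply, ← LinearMap.mem_ker, S.ker_mkQ]
    exact hf0 x

theorem isInputContainingFriend_iff_dual {G : Matrix (Fin n) (Fin p) ℝ} :
    IsInputContainingFriend A B C D S G ↔
      IsOutputNullingFriend Aᵀ Cᵀ Bᵀ Dᵀ (dotPerp S) Gᵀ := by
  have h1 : Aᵀ + Cᵀ * Gᵀ = (A + G * C)ᵀ := by
    rw [Matrix.transpose_add, Matrix.transpose_mul]
  have h2 : Bᵀ + Dᵀ * Gᵀ = (B + G * D)ᵀ := by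
    rw [Matrix.transpose_add, Matrix.transpose_mul]
  rw [isInputContainingFriend_iff, isOutputNullingFriend_iff, h1, h2]
  constructor
  · intro h y hy
    refine ⟨fun x hx => ?_, ?_⟩
    · rw [← dotProduct_mulVec_transpose]
      simpa using hy _ (h x hx 0)
    · refine dotProduct_eq_zero _ fun w => ?_
      rw [← dotProduct_mulVec_transpose]
      simpa using hy _ (h 0 S.zero_mem w)
  · intro h x hx w
    rw [← dotPerp_dotPerp S]
    intro y hy
    rw [dotProduct_comm, dotProduct_add, dotProduct_mulVec_transpose, dotProduct_mulVec_transpose,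
      (h y hy).2, (h y hy).1 x hx, zero_dotProduct, add_zero]

theorem isDetectabilityInputContaining_iff_dual {T : TimeDomain} :
    IsDetectabilityInputContaining A B C D T S ↔
      IsStabilizabilityOutputNulling Aᵀ Cᵀ Bᵀ Dᵀ T (dotPerp S) := by
  rw [isDetectabilityInputContaining_iff, isStabilizabilityOutputNulling_iff]
  have key : ∀ (G : Matrix (Fin n) (Fin p) ℝ) (f : ℝ[X]),
      (∀ x, aeval (A + G * C).mulVecLin f x ∈ S) ↔
        ∀ y ∈ dotPerp S, aeval (Aᵀ + Cᵀ * Gᵀ).mulVecLin f y = 0 := fun G f => by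
    have h1 : Aᵀ + Cᵀ * Gᵀ = (A + G * C)ᵀ := by
      rw [Matrix.transpose_add, Matrix.transpose_mul]
    rw [h1]
    constructor
    · intro h y hy
      refine dotProduct_eq_zero _ fun x => ?_
      rw [← dotProduct_aeval_transpose]
      exact hy _ (h x)
    · intro h x
      rw [← dotPerp_dotPerp S]
      intro y hy
      rw [dotProduct_comm, dotProduct_aeval_transpose, h y hy, zero_dotProduct]
  constructor
  · rintro ⟨G, hG, f, hf, h⟩
    exact ⟨Gᵀ, isInputContainingFriend_iff_dual.mp hG, f, hf, (key G f).mp h⟩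
  · rintro ⟨F, hF, f, hf, h⟩
    rw [← F.transpose_transpose] at hF h
    exact ⟨Fᵀ, isInputContainingFriend_iff_dual.mpr hF, f, hf, (key Fᵀ f).mpr h⟩

theorem mulVecLin_add_mul (F : Matrix (Fin m) (Fin n) ℝ) (A : Matrix (Fin p) (Fin n) ℝ)
    (B : Matrix (Fin p) (Fin m) ℝ) :
    (A + B * F).mulVecLin = A.mulVecLin + B.mulVecLin ∘ₗ F.mulVecLin := by
  rw [Matrix.mulVecLin_add, Matrix.mulVecLin_mul]

theorem exists_mulVecLin_eq (F : (Fin n → ℝ) →ₗ[ℝ] (Fin m → ℝ)) :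
    ∃ M : Matrix (Fin m) (Fin n) ℝ, M.mulVecLin = F :=
  ⟨LinearMap.toMatrix' F, Matrix.toLin'_toMatrix' F⟩

/-- A stabilizability output nulling subspace has a friend that is stable on it; a correction of
that friend off the subspace makes the whole system stable. -/
theorem IsStabilizabilityOutputNulling.exists_stabilizing_friend {T : TimeDomain}
    (hV : IsStabilizabilityOutputNulling A B C D T V) (hAB : IsStabilizablePair T A B) :
    ∃ F : Matrix (Fin m) (Fin n) ℝ,
      IsOutputNullingFriend A B C D V F ∧ IsAsympStable T (A + B * F) := by
  obtain ⟨F₀, hF₀, hs⟩ := isStabilizabilityOutputNulling_iff.mp hV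
  obtain ⟨F', hF'⟩ := hAB
  rw [isAsympStable_iff] at hF'
  have hF'' : A + B * F' = (A + B * F₀) + B * (F' - F₀) := by rw [Matrix.mul_sub]; abel
  rw [hF'', mulVecLin_add_mul] at hF'
  obtain ⟨F₁, hF₁, hst⟩ := exists_stabilizing_feedback T (A := (A + B * F₀).mulVecLin)
    (B := B.mulVecLin) (V := V) hF₀.mapsTo hs
    (fun N _ hN hB => stable_mod_of_stabilizable hF' hN hB)
  obtain ⟨F₁, rfl⟩ := exists_mulVecLin_eq F₁
  refine ⟨F₀ + F₁, ?_, ?_⟩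
  · rw [isOutputNullingFriend_iff] at hF₀ ⊢
    intro x hx
    have h0 : F₁ *ᵥ x = 0 := hF₁ x hx
    have h1 : (F₀ + F₁) *ᵥ x = F₀ *ᵥ x := by rw [Matrix.add_mulVec, h0, add_zero]
    have h2 := hF₀ x hx
    simp only [Matrix.add_mulVec _ _ x, ← Matrix.mulVec_mulVec] at h2 ⊢
    rwa [h0, add_zero]
  · rw [isAsympStable_iff, Matrix.mul_add, ← add_assoc, mulVecLin_add_mul]
    exact hst

theorem IsDetectabilityInputContaining.exists_stabilizing_friend {T : TimeDomain}
    (hS : IsDetectabilityInputContaining A B C D T S) (hCA : IsDetectablePair T C A) :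
    ∃ G : Matrix (Fin n) (Fin p) ℝ,
      IsInputContainingFriend A B C D S G ∧ IsAsympStable T (A + G * C) := by
  have htr : ∀ G : Matrix (Fin n) (Fin p) ℝ,
      IsAsympStable T (Aᵀ + Cᵀ * Gᵀ) ↔ IsAsympStable T (A + G * C) := fun G => by
    rw [← Matrix.transpose_mul, ← Matrix.transpose_add, isAsympStable_transpose]
  obtain ⟨G', hG'⟩ := hCA
  obtain ⟨F, hF, hs⟩ := (isDetectabilityInputContaining_iff_dual.mp hS).exists_stabilizing_friend
    ⟨G'ᵀ, (htr G').mpr hG'⟩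
  rw [← F.transpose_transpose] at hF hs
  exact ⟨Fᵀ, isInputContainingFriend_iff_dual.mpr hF, (htr Fᵀ).mp hs⟩

end Friends

/-! ### Closed loops with the decoupling compensator -/

section Conditions

variable {n m q p r : ℕ} {P : Plant n m q p r} {V S : Submodule ℝ (Fin n → ℝ)}
  {K : Matrix (Fin m) (Fin p) ℝ}

theorem Plant.GeometricConditions.mem_of_mem (h : P.GeometricConditions V S K) {x : Fin n → ℝ}
    (hx : x ∈ S) (w : Fin q → ℝ) :
    (P.A + P.B * K * P.C) *ᵥ x + (P.H + P.B * K * P.Gy) *ᵥ w ∈ V ∧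
      (P.E + P.Dz * K * P.C) *ᵥ x + (P.Gz + P.Dz * K * P.Gy) *ᵥ w = 0 :=
  h.cond_iv_incl ⟨(x, w), ⟨hx, trivial⟩, rfl⟩

end Conditions

namespace Plant

variable {n m q p r : ℕ} (P : Plant n m q p r) (F : Matrix (Fin m) (Fin n) ℝ)
  (G : Matrix (Fin n) (Fin p) ℝ) {K : Matrix (Fin m) (Fin p) ℝ}

theorem one_sub_Dy_mul_Dc_mul_one_add (hK : IsUnit (1 + K * P.Dy)) :
    (1 - P.Dy * (P.decouplingCompensator F G K).Dc) * (1 + P.Dy * K) = 1 := by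
  have hM : (1 + K * P.Dy)⁻¹ * (1 + K * P.Dy) = 1 :=
    Matrix.nonsing_inv_mul _ ((Matrix.isUnit_iff_isUnit_det _).mp hK)
  have h1 : (1 + K * P.Dy)⁻¹ * (K * (1 + P.Dy * K)) = K := by
    have : K * (1 + P.Dy * K) = (1 + K * P.Dy) * K := by
      rw [Matrix.mul_add, Matrix.add_mul, Matrix.mul_one, Matrix.one_mul, Matrix.mul_assoc]
    rw [this, ← Matrix.mul_assoc, hM, Matrix.one_mul]
  rw [Matrix.sub_mul, Matrix.one_mul, decouplingCompensator, Matrix.mul_assoc, Matrix.mul_assoc,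
    h1, add_sub_cancel_right]

theorem isWellPosed_decouplingCompensator (hK : IsUnit (1 + K * P.Dy)) :
    P.IsWellPosed (P.decouplingCompensator F G K) :=
  IsUnit.of_mul_eq_one _ (P.one_sub_Dy_mul_Dc_mul_one_add F G hK)

theorem W_decouplingCompensator (hK : IsUnit (1 + K * P.Dy)) :
    P.W (P.decouplingCompensator F G K) = 1 + P.Dy * K :=
  Matrix.inv_eq_right_inv (P.one_sub_Dy_mul_Dc_mul_one_add F G hK)

theorem Dc_mul_W_decouplingCompensator (hK : IsUnit (1 + K * P.Dy)) :
    (P.decouplingCompensator F G K).Dc * P.W (P.decouplingCompensator F G K) = K := by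
  have hM : (1 + K * P.Dy)⁻¹ * (1 + K * P.Dy) = 1 :=
    Matrix.nonsing_inv_mul _ ((Matrix.isUnit_iff_isUnit_det _).mp hK)
  have : K * (1 + P.Dy * K) = (1 + K * P.Dy) * K := by
    rw [Matrix.mul_add, Matrix.add_mul, Matrix.mul_one, Matrix.one_mul, Matrix.mul_assoc]
  rw [P.W_decouplingCompensator F G hK, decouplingCompensator, Matrix.mul_assoc, this,
    ← Matrix.mul_assoc, hM, Matrix.one_mul]

theorem Bc_mul_W_decouplingCompensator (hK : IsUnit (1 + K * P.Dy)) :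
    (P.decouplingCompensator F G K).Bc * P.W (P.decouplingCompensator F G K) = P.B * K - G := by
  have h := P.Dc_mul_W_decouplingCompensator F G hK
  have hB : (P.decouplingCompensator F G K).Bc =
      (P.B + G * P.Dy) * (P.decouplingCompensator F G K).Dc - G := by
    simp only [decouplingCompensator, Matrix.mul_assoc]
  rw [hB, Matrix.sub_mul, Matrix.mul_assoc, h, P.W_decouplingCompensator F G hK, Matrix.add_mul,
    Matrix.mul_add, Matrix.mul_one, Matrix.mul_assoc]
  abel

theorem Cc_decouplingCompensator (hK : IsUnit (1 + K * P.Dy)) :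
    (P.decouplingCompensator F G K).Cc + K * (P.Dy * (P.decouplingCompensator F G K).Cc) =
      F - K * P.C := by
  have hM : (1 + K * P.Dy) * (1 + K * P.Dy)⁻¹ = 1 :=
    Matrix.mul_nonsing_inv _ ((Matrix.isUnit_iff_isUnit_det _).mp hK)
  have : (P.decouplingCompensator F G K).Cc + K * (P.Dy * (P.decouplingCompensator F G K).Cc) =
      (1 + K * P.Dy) * (P.decouplingCompensator F G K).Cc := by
    rw [Matrix.add_mul, Matrix.one_mul, Matrix.mul_assoc]
  rw [this, decouplingCompensator, ← Matrix.mul_assoc, hM, Matrix.one_mul]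

theorem clA_decouplingCompensator (hK : IsUnit (1 + K * P.Dy)) :
    P.clA (P.decouplingCompensator F G K) = Matrix.fromBlocks
      (P.A + P.B * K * P.C) (P.B * (F - K * P.C))
      ((P.B * K - G) * P.C) (P.A + G * P.C + P.B * (F - K * P.C)) := by
  have h1 := P.Dc_mul_W_decouplingCompensator F G hK
  have h2 := P.Bc_mul_W_decouplingCompensator F G hK
  have h3 := P.Cc_decouplingCompensator F G hK
  have h4 : (P.decouplingCompensator F G K).Ac = P.A + G * P.C +
      (P.B + G * P.Dy) * (P.decouplingCompensator F G K).Cc := by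
    simp only [decouplingCompensator, Matrix.mul_assoc]
  rw [clA, Matrix.mul_assoc P.B, h1, h2, h4, ← h3]
  congr 1
  · simp only [Matrix.mul_add, Matrix.mul_assoc]
  · simp only [Matrix.mul_add, Matrix.add_mul, Matrix.sub_mul, Matrix.mul_assoc]
    abel

theorem clH_decouplingCompensator (hK : IsUnit (1 + K * P.Dy)) :
    P.clH (P.decouplingCompensator F G K) = Matrix.fromRows
      (P.H + P.B * K * P.Gy) ((P.B * K - G) * P.Gy) := by
  rw [clH, Matrix.mul_assoc P.B, P.Dc_mul_W_decouplingCompensator F G hK,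
    P.Bc_mul_W_decouplingCompensator F G hK]

theorem clC_decouplingCompensator (hK : IsUnit (1 + K * P.Dy)) :
    P.clC (P.decouplingCompensator F G K) = Matrix.fromCols
      (P.E + P.Dz * K * P.C) (P.Dz * (F - K * P.C)) := by
  rw [clC, Matrix.mul_assoc P.Dz, P.Dc_mul_W_decouplingCompensator F G hK,
    ← P.Cc_decouplingCompensator F G hK]
  simp only [Matrix.mul_add, Matrix.mul_assoc]

theorem clG_decouplingCompensator (hK : IsUnit (1 + K * P.Dy)) :
    P.clG (P.decouplingCompensator F G K) = P.Gz + P.Dz * K * P.Gy := by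
  rw [clG, Matrix.mul_assoc P.Dz, P.Dc_mul_W_decouplingCompensator F G hK]

/-- In the coordinates `(x, x - p)`, plant state and estimation error, the closed loop is block
triangular: the error evolves by `A + G C` on its own and drives the state, which evolves by
`A + B F`. -/
theorem matSpectrum_clA_decouplingCompensator (hK : IsUnit (1 + K * P.Dy)) :
    matSpectrum (P.clA (P.decouplingCompensator F G K)) =
      matSpectrum (P.A + P.B * F) + matSpectrum (P.A + G * P.C) := by
  let R : Matrix (Fin n ⊕ Fin n) (Fin n ⊕ Fin n) ℝ := Matrix.fromBlocks 1 0 1 (-1)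
  have hRR : R * R = 1 := by simp [R, Matrix.fromBlocks_multiply, ← Matrix.fromBlocks_one]
  have hconj : R * (P.clA (P.decouplingCompensator F G K) * R) = Matrix.fromBlocks
      (P.A + P.B * F) (-(P.B * (F - K * P.C))) 0 (P.A + G * P.C) := by
    rw [P.clA_decouplingCompensator F G hK]
    simp only [R, Matrix.fromBlocks_multiply]
    congr 1 <;>
    simp [Matrix.mul_sub, Matrix.sub_mul, Matrix.mul_assoc]
    · abel
    · abel
  have hchar : (P.clA (P.decouplingCompensator F G K)).charpoly =
      (P.A + P.B * F).charpoly * (P.A + G * P.C).charpoly := by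
    rw [← Matrix.charpoly_fromBlocks_zero₂₁, ← hconj, Matrix.charpoly_mul_comm, Matrix.mul_assoc,
      hRR, Matrix.mul_one]
  rw [matSpectrum, hchar, Polynomial.map_mul, Polynomial.roots_mul]
  · rfl
  · exact mul_ne_zero ((Matrix.charpoly_monic _).map _).ne_zero
      ((Matrix.charpoly_monic _).map _).ne_zero

/-- The subspace of all `(x, p)` with `x ∈ V` and `x - p ∈ S` is invariant under the closed loop,
contains the effect of the disturbance and is not seen at the output. -/
theorem transferMatrix_decouplingCompensator {F : Matrix (Fin m) (Fin n) ℝ}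
    {G : Matrix (Fin n) (Fin p) ℝ} {V S : Submodule ℝ (Fin n → ℝ)}
    (h : P.GeometricConditions V S K) (hF : IsOutputNullingFriend P.A P.B P.E P.Dz V F)
    (hG : IsInputContainingFriend P.A P.H P.C P.Gy S G) :
    transferMatrix (P.clA (P.decouplingCompensator F G K)) (P.clH (P.decouplingCompensator F G K))
      (P.clC (P.decouplingCompensator F G K)) (P.clG (P.decouplingCompensator F G K)) = 0 := by
  have hK := h.cond_iv_wellPosed
  rw [isOutputNullingFriend_iff] at hF
  rw [isInputContainingFriend_iff] at hG
  rw [transferMatrix_eq_zero_iff_exists_invariant, P.clA_decouplingCompensator F G hK,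
    P.clH_decouplingCompensator F G hK, P.clC_decouplingCompensator F G hK,
    P.clG_decouplingCompensator F G hK]
  refine ⟨Matrix.ext_of_mulVec_single fun j => ?_, ?_⟩
  · have := (h.mem_of_mem S.zero_mem (Pi.single j 1)).2
    rw [Matrix.mulVec_zero, zero_add] at this
    rw [this, Matrix.zero_mulVec]
  let πx : (Fin n ⊕ Fin n → ℝ) →ₗ[ℝ] (Fin n → ℝ) := LinearMap.funLeft ℝ ℝ Sum.inl
  let πp : (Fin n ⊕ Fin n → ℝ) →ₗ[ℝ] (Fin n → ℝ) := LinearMap.funLeft ℝ ℝ Sum.inr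
  -- the feedback acts on `V` through `F` and on the error through `F - K C`
  have herr : ∀ e ∈ S, (P.B * (F - K * P.C)) *ᵥ e ∈ V ∧ (P.Dz * (F - K * P.C)) *ᵥ e = 0 := by
    intro e he
    have h1 := hF e (h.cond_iii he)
    have h2 := h.mem_of_mem he 0
    rw [Matrix.mulVec_zero, Matrix.mulVec_zero, add_zero, add_zero] at h2
    have h3 : P.B * (F - K * P.C) = (P.A + P.B * F) - (P.A + P.B * K * P.C) := by
      rw [Matrix.mul_sub, Matrix.mul_assoc]; abel
    have h4 : P.Dz * (F - K * P.C) = (P.E + P.Dz * F) - (P.E + P.Dz * K * P.C) := by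
      rw [Matrix.mul_sub, Matrix.mul_assoc]; abel
    rw [h3, h4, Matrix.sub_mulVec, Matrix.sub_mulVec, h1.2, h2.2, sub_zero]
    exact ⟨V.sub_mem h1.1 h2.1, rfl⟩
  refine ⟨V.comap πx ⊓ S.comap (πx - πp), fun v hv => ?_, fun w => ?_, fun v hv => ?_⟩
  · obtain ⟨x, y, rfl⟩ : ∃ x y, v = Sum.elim x y := ⟨v ∘ Sum.inl, v ∘ Sum.inr, by simp⟩
    have hx : x ∈ V := hv.1
    have he : x - y ∈ S := hv.2
    rw [Matrix.fromBlocks_mulVec, Sum.elim_comp_inl, Sum.elim_comp_inr]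
    constructor
    · change (P.A + P.B * K * P.C) *ᵥ x + (P.B * (F - K * P.C)) *ᵥ y ∈ V
      have := V.sub_mem (hF x hx).1 (herr _ he).1
      convert this using 1
      simp only [Matrix.mul_sub, Matrix.add_mulVec, Matrix.sub_mulVec, Matrix.mulVec_sub,
        Matrix.mul_assoc]
      abel
    · change ((P.A + P.B * K * P.C) *ᵥ x + (P.B * (F - K * P.C)) *ᵥ y) -
        (((P.B * K - G) * P.C) *ᵥ x + (P.A + G * P.C + P.B * (F - K * P.C)) *ᵥ y) ∈ S
      have := hG _ he 0
      convert this using 1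
      simp only [Matrix.mul_sub, Matrix.sub_mul, Matrix.add_mulVec, Matrix.sub_mulVec,
        Matrix.mulVec_sub, Matrix.mul_assoc, Matrix.mulVec_zero]
      abel
  · rw [Matrix.fromRows_mulVec]
    constructor
    · have := (h.mem_of_mem S.zero_mem w).1
      rwa [Matrix.mulVec_zero, zero_add] at this
    · change (P.H + P.B * K * P.Gy) *ᵥ w - ((P.B * K - G) * P.Gy) *ᵥ w ∈ S
      have := hG 0 S.zero_mem w
      rw [Matrix.mulVec_zero, zero_add] at this
      convert this using 1
      simp only [Matrix.sub_mul, Matrix.add_mulVec, Matrix.sub_mulVec]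
      abel
  · obtain ⟨x, y, rfl⟩ : ∃ x y, v = Sum.elim x y := ⟨v ∘ Sum.inl, v ∘ Sum.inr, by simp⟩
    have hx : x ∈ V := hv.1
    have he : x - y ∈ S := hv.2
    rw [Matrix.fromCols_mulVec, Sum.elim_comp_inl, Sum.elim_comp_inr]
    have h1 := (hF x hx).2
    have h2 := (herr _ he).2
    have h3 := congrArg₂ (· - ·) h1 h2
    simp only [sub_zero] at h3
    rw [← h3]
    simp only [Matrix.mul_sub, Matrix.add_mulVec, Matrix.sub_mulVec, Matrix.mulVec_sub,
      Matrix.mul_assoc]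
    abel

theorem solvesDDPStable_decouplingCompensator {T : TimeDomain} {F : Matrix (Fin m) (Fin n) ℝ}
    {G : Matrix (Fin n) (Fin p) ℝ} {V S : Submodule ℝ (Fin n → ℝ)}
    (h : P.GeometricConditions V S K) (hF : IsOutputNullingFriend P.A P.B P.E P.Dz V F)
    (hFs : IsAsympStable T (P.A + P.B * F)) (hG : IsInputContainingFriend P.A P.H P.C P.Gy S G)
    (hGs : IsAsympStable T (P.A + G * P.C)) :
    P.SolvesDDPStable (P.decouplingCompensator F G K) T := by
  refine ⟨P.isWellPosed_decouplingCompensator F G h.cond_iv_wellPosed,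
    P.transferMatrix_decouplingCompensator h hF hG, fun z hz => ?_⟩
  rw [P.matSpectrum_clA_decouplingCompensator F G h.cond_iv_wellPosed, Multiset.mem_add] at hz
  exact hz.elim (hFs z) (hGs z)

end Plant

/-! ### Necessity -/

/-- The projection of an invariant subspace of a stable closed loop onto the plant state is a
stabilizability output nulling subspace, if the closed-loop output vanishes on it. -/
theorem isStabilizabilityOutputNulling_map_inl {T : TimeDomain} {n m r s : ℕ}
    {A : Matrix (Fin n) (Fin n) ℝ} {B : Matrix (Fin n) (Fin m) ℝ} {E : Matrix (Fin r) (Fin n) ℝ}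
    {D : Matrix (Fin r) (Fin m) ℝ} {M : Matrix (Fin n ⊕ Fin s) (Fin n ⊕ Fin s) ℝ}
    (κ : Matrix (Fin m) (Fin n ⊕ Fin s) ℝ) {L : Submodule ℝ (Fin n ⊕ Fin s → ℝ)}
    (hM : IsAsympStable T M) (hL : ∀ v ∈ L, M *ᵥ v ∈ L)
    (hA : ∀ v ∈ L, A *ᵥ (v ∘ Sum.inl) + B *ᵥ (κ *ᵥ v) = (M *ᵥ v) ∘ Sum.inl)
    (hE : ∀ v ∈ L, E *ᵥ (v ∘ Sum.inl) + D *ᵥ (κ *ᵥ v) = 0) :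
    IsStabilizabilityOutputNulling A B E D T (L.map (LinearMap.funLeft ℝ ℝ Sum.inl)) := by
  obtain ⟨F, hF, hs⟩ := exists_stable_friend_of_image (T := T) (A := A.mulVecLin)
    (B := B.mulVecLin) (E := E.mulVecLin) (D := D.mulVecLin) (Φ := M.mulVecLin)
    (π := LinearMap.funLeft ℝ ℝ Sum.inl) (κ := κ.mulVecLin) hL
    ((isAsympStable_iff T M).mp hM) hA hE
  obtain ⟨F, rfl⟩ := exists_mulVecLin_eq F
  simp only [← mulVecLin_add_mul] at hF hs
  exact isStabilizabilityOutputNulling_iff.mpr ⟨F, isOutputNullingFriend_iff.mpr hF, hs⟩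

namespace Plant

variable {n m q p r s : ℕ} (P : Plant n m q p r)

/-- From a solution, with `L` an invariant subspace between the effect of the disturbance and the
kernel of the output: `V` is the projection of `L` onto the plant state, `S` is its intersection
with the plant state space, and `K = D_c W`. As the complement of `S` is the projection of the
complement of `L`, the claim on `S` is the one on `V` for the transposed closed loop. -/
theorem exists_geometricConditions {T : TimeDomain} (c : Compensator m p s)
    (hc : P.SolvesDDPStable c T) :
    ∃ (V S : Submodule ℝ (Fin n → ℝ)) (K : Matrix (Fin m) (Fin p) ℝ),
      IsStabilizabilityOutputNulling P.A P.B P.E P.Dz T V ∧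
      IsDetectabilityInputContaining P.A P.H P.C P.Gy T S ∧
      P.GeometricConditions V S K := by
  obtain ⟨hwp, htr, hst⟩ := hc
  rw [transferMatrix_eq_zero_iff_exists_invariant] at htr
  obtain ⟨hG0, L, hLA, hLH, hLC⟩ := htr
  set K := c.Dc * P.W c with hKdef
  set Φ := c.Cc + K * P.Dy * c.Cc with hΦ
  set Ψ := c.Bc * P.W c with hΨ
  set Θ := c.Ac + Ψ * P.Dy * c.Cc with hΘ
  have hA : P.clA c = Matrix.fromBlocks (P.A + P.B * K * P.C) (P.B * Φ) (Ψ * P.C) Θ := by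
    simp only [clA, hΦ, hKdef, hΨ, hΘ, Matrix.mul_add, Matrix.mul_assoc]
  have hH : P.clH c = Matrix.fromRows (P.H + P.B * K * P.Gy) (Ψ * P.Gy) := by
    simp only [clH, hKdef, hΨ, Matrix.mul_assoc]
  have hC : P.clC c = Matrix.fromCols (P.E + P.Dz * K * P.C) (P.Dz * Φ) := by
    simp only [clC, hΦ, hKdef, Matrix.mul_add, Matrix.mul_assoc]
  have hGz : P.Gz + P.Dz * K * P.Gy = 0 := by
    rw [← hG0]
    simp only [clG, hKdef, Matrix.mul_assoc]
  have hKu : IsUnit (1 + K * P.Dy) := by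
    have hW : P.W c * (1 - P.Dy * c.Dc) = 1 :=
      Matrix.nonsing_inv_mul _ ((Matrix.isUnit_iff_isUnit_det _).mp hwp)
    refine IsUnit.of_mul_eq_one (1 - c.Dc * P.Dy) ?_
    have h1 : P.Dy * (1 - c.Dc * P.Dy) = (1 - P.Dy * c.Dc) * P.Dy := by
      rw [Matrix.mul_sub, Matrix.sub_mul, Matrix.mul_one, Matrix.one_mul, Matrix.mul_assoc]
    rw [Matrix.add_mul, Matrix.one_mul, Matrix.mul_assoc, h1, hKdef, Matrix.mul_assoc,
      ← Matrix.mul_assoc (P.W c), hW, Matrix.one_mul, sub_add_cancel]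
  let π : (Fin n ⊕ Fin s → ℝ) →ₗ[ℝ] (Fin n → ℝ) := LinearMap.funLeft ℝ ℝ Sum.inl
  have hV : IsStabilizabilityOutputNulling P.A P.B P.E P.Dz T (L.map π) := by
    refine isStabilizabilityOutputNulling_map_inl (Matrix.fromCols (K * P.C) Φ) hst hLA
      (fun v _ => ?_) fun v hv => ?_
    · rw [hA, Matrix.fromBlocks_mulVec, Sum.elim_comp_inl, Matrix.fromCols_mulVec]
      simp only [Matrix.add_mulVec, Matrix.mulVec_add, Matrix.mulVec_mulVec, Matrix.mul_assoc]
      abel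
    · rw [← hLC v hv, hC, Matrix.fromCols_mulVec, Matrix.fromCols_mulVec]
      simp only [Matrix.add_mulVec, Matrix.mulVec_add, Matrix.mulVec_mulVec, Matrix.mul_assoc]
      abel
  have hV' : IsStabilizabilityOutputNulling P.Aᵀ P.Cᵀ P.Hᵀ P.Gyᵀ T ((dotPerp L).map π) := by
    refine isStabilizabilityOutputNulling_map_inl (Matrix.fromCols (P.B * K)ᵀ Ψᵀ)
      (M := (P.clA c)ᵀ) ((isAsympStable_transpose T _).mpr hst) (fun y hy x hx => ?_)
      (fun v _ => ?_) fun v hv => ?_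
    · rw [← dotProduct_mulVec_transpose]
      exact hy _ (hLA x hx)
    · rw [hA, Matrix.fromBlocks_transpose, Matrix.fromBlocks_mulVec, Sum.elim_comp_inl,
        Matrix.fromCols_mulVec, Matrix.transpose_add, Matrix.transpose_mul _ P.C,
        Matrix.transpose_mul Ψ]
      simp only [Matrix.add_mulVec, Matrix.mulVec_add, Matrix.mulVec_mulVec]
      abel
    · have h1 : (P.clH c)ᵀ *ᵥ v = 0 := dotProduct_eq_zero _ fun w => by
        rw [← dotProduct_mulVec_transpose]
        exact hv _ (hLH w)
      rw [← h1, hH, Matrix.transpose_fromRows, Matrix.fromCols_mulVec, Matrix.fromCols_mulVec,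
        Matrix.transpose_add, Matrix.transpose_mul _ P.Gy, Matrix.transpose_mul Ψ]
      simp only [Matrix.add_mulVec, Matrix.mulVec_add, Matrix.mulVec_mulVec]
      abel
  set S := dotPerp ((dotPerp L).map π) with hS
  have hSL : ∀ x ∈ S, Sum.elim x 0 ∈ L := fun x hx => by
    rw [← dotPerp_dotPerp L]
    intro y hy
    have h1 : x ⬝ᵥ π y = 0 := hx _ ⟨y, hy, rfl⟩
    rw [← h1]
    simp [dotProduct, π, LinearMap.funLeft_apply]
  -- the closed loop started in `(x, 0)`, with `x ∈ S`, under the disturbance `w`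
  have hmem : ∀ x ∈ S, ∀ w, (P.A + P.B * K * P.C) *ᵥ x + (P.H + P.B * K * P.Gy) *ᵥ w ∈ L.map π ∧
      (P.E + P.Dz * K * P.C) *ᵥ x + (P.Gz + P.Dz * K * P.Gy) *ᵥ w = 0 := fun x hx w => by
    constructor
    · refine ⟨_, L.add_mem (hLA _ (hSL x hx)) (hLH w), ?_⟩
      rw [hA, hH, Matrix.fromBlocks_mulVec, Matrix.fromRows_mulVec]
      ext i
      simp [π, LinearMap.funLeft_apply]
    · have h1 := hLC _ (hSL x hx)
      rw [hC, Matrix.fromCols_mulVec, Sum.elim_comp_inl, Sum.elim_comp_inr, Matrix.mulVec_zero,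
        add_zero] at h1
      rw [h1, hGz, Matrix.zero_mulVec, add_zero]
  refine ⟨L.map π, S, K, hV, ?_, ?_, ?_, ?_, hKu, ?_⟩
  · rw [isDetectabilityInputContaining_iff_dual, hS, dotPerp_dotPerp]
    exact hV'
  · rintro _ ⟨w, rfl⟩
    obtain ⟨h1, h2⟩ := hmem 0 S.zero_mem w
    refine Submodule.mem_sup.mpr ⟨(_, _), ⟨h1, h2⟩, _, ⟨-(K *ᵥ (P.Gy *ᵥ w)), rfl⟩, ?_⟩
    ext <;> simp [Matrix.add_mulVec, Matrix.mulVec_neg, Matrix.mul_assoc]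
  · rw [eq_bot_iff]
    rintro _ ⟨⟨x, w⟩, ⟨⟨hx, -⟩, hxw⟩, rfl⟩
    have hxw' : P.C *ᵥ x + P.Gy *ᵥ w = 0 := hxw
    have h1 := (hmem x hx w).2
    have h2 : (P.E + P.Dz * K * P.C) *ᵥ x + (P.Gz + P.Dz * K * P.Gy) *ᵥ w =
        P.E *ᵥ x + P.Gz *ᵥ w + (P.Dz * K) *ᵥ (P.C *ᵥ x + P.Gy *ᵥ w) := by
      simp only [Matrix.add_mulVec, Matrix.mulVec_add, Matrix.mulVec_mulVec]
      abel
    rw [h2, hxw', Matrix.mulVec_zero, add_zero] at h1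
    exact h1
  · intro x hx
    exact ⟨_, hSL x hx, funext fun i => by simp [π, LinearMap.funLeft_apply]⟩
  · rintro _ ⟨⟨x, w⟩, ⟨hx, -⟩, rfl⟩
    exact hmem x hx w

end Plant


theorem mainTheorem5 (T : TimeDomain) {n m q p r : ℕ} (P : Plant n m q p r)
    (hAB : IsStabilizablePair T P.A P.B) (hCA : IsDetectablePair T P.C P.A) :
    (P.DDPStableSolvable T ↔
      ∃ (V S : Submodule ℝ (Fin n → ℝ)) (K : Matrix (Fin m) (Fin p) ℝ),
        IsStabilizabilityOutputNulling P.A P.B P.E P.Dz T V ∧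
        IsDetectabilityInputContaining P.A P.H P.C P.Gy T S ∧
        P.GeometricConditions V S K) ∧
    (∀ (V S : Submodule ℝ (Fin n → ℝ)) (K : Matrix (Fin m) (Fin p) ℝ),
      IsStabilizabilityOutputNulling P.A P.B P.E P.Dz T V →
      IsDetectabilityInputContaining P.A P.H P.C P.Gy T S →
      P.GeometricConditions V S K →
      (∃ F : Matrix (Fin m) (Fin n) ℝ,
        IsOutputNullingFriend P.A P.B P.E P.Dz V F ∧ IsAsympStable T (P.A + P.B * F)) ∧
      (∃ G : Matrix (Fin n) (Fin p) ℝ,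
        IsInputContainingFriend P.A P.H P.C P.Gy S G ∧ IsAsympStable T (P.A + G * P.C)) ∧
      (∀ (F : Matrix (Fin m) (Fin n) ℝ) (G : Matrix (Fin n) (Fin p) ℝ),
        IsOutputNullingFriend P.A P.B P.E P.Dz V F → IsAsympStable T (P.A + P.B * F) →
        IsInputContainingFriend P.A P.H P.C P.Gy S G → IsAsympStable T (P.A + G * P.C) →
        P.SolvesDDPStable (P.decouplingCompensator F G K) T ∧
        matSpectrum (P.clA (P.decouplingCompensator F G K)) =
          matSpectrum (P.A + P.B * F) + matSpectrum (P.A + G * P.C))) := by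
  refine ⟨⟨fun ⟨s, c, hc⟩ => P.exists_geometricConditions c hc, ?_⟩,
    fun V S K hV hS h => ⟨hV.exists_stabilizing_friend hAB, hS.exists_stabilizing_friend hCA,
      fun F G hF hFs hG hGs => ⟨P.solvesDDPStable_decouplingCompensator h hF hFs hG hGs,
        P.matSpectrum_clA_decouplingCompensator F G h.cond_iv_wellPosed⟩⟩⟩
  rintro ⟨V, S, K, hV, hS, h⟩
  obtain ⟨F, hF, hFs⟩ := hV.exists_stabilizing_friend hAB
  obtain ⟨G, hG, hGs⟩ := hS.exists_stabilizing_friend hCA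
  exact ⟨n, _, P.solvesDDPStable_decouplingCompensator h hF hFs hG hGs⟩
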